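/- Let $n\ge 1$, $N=2n$, and let $(\cdot,\cdot)$ be the standard bilinear form on $\mathbb{C}^N$. For $r=(r_1,\dots,r_{2n})^t\in\mathbb{C}^N$ put $\bar r=(r_{n+1},\dots,r_{2n},-r_1,\dots,-r_n)^t$. Let $\mathfrak{sp}_N\subset\mathfrak{gl}_N$ be the symplectic Lie algebra over $\mathbb{C}$, i.e. the span of $h_i=e_{i,i}-e_{n+i,n+i}$, $X_{\epsilon_i-\epsilon_j}=e_{i,j}-e_{n+j,n+i}$ $(i\ne j)$, $X_{\epsilon_k+\epsilon_l}=e_{k,n+l}+e_{l,n+k}$ and $X_{-\epsilon_k-\epsilon_l}=e_{n+k,l}+e_{n+l,k}$ $(k\le l)$, with all indices in $\{1,\dots,n\}$, where $\epsilon_i(h_j)=\delta_{ij}$; the positive roots are $\epsilon_i-\epsilon_j$ $(i<j)$ and $\epsilon_k+\epsilon_l$ $(k\le l)$. It contains $r\bar r^{\,t}$ for every $r\in\mathbb{Z}^N$. For $0\le k\le n$ let $V(\delta_k)$ be the irreducible $\mathfrak{sp}_N$-module of highest weight $\delta_k=\epsilon_1+\dots+\epsilon_k$ (so $\delta_0=0$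 and $V(\delta_0)\cong\mathbb{C}$ is the trivial module). Let $A_N=\mathbb{C}[t_1^{\pm1},\dots,t_N^{\pm1}]$, $d_i=t_i\frac{\partial}{\partial t_i}$ and $H_r=\sum_{i=1}^N\bar r_i\,t^r d_i$ for $r\in\mathbb{Z}^N$. The Hamiltonian Lie algebra is the Lie subalgebra $$\mathfrak{H}_N=\operatorname{span}_{\mathbb{C}}\{H_r: r\in\mathbb{Z}^N\setminus\{0\}\}\oplus\bigoplus_{i=1}^N\mathbb{C}d_i$$ of $\operatorname{Der}(A_N)$. For an $\mathfrak{sp}_N$-module $V$ and $\alpha,\beta\in\mathbb{C}^N$ let $F^{\alpha,\beta}(V)=V\otimes A_N$ be the $\mathfrak{H}_N$-module with action $$H_r(v\otimes t^s)=\big((\bar r,s+\alpha)v+(r\bar r^{\,t})v\big)\otimes t^{r+s},\qquad d_i(v\otimes t^s)=(s_i+\beta_i)\,v\otimes t^s\qquad(v\in V,\ s\in\mathbb{Z}^N).$$ Theorem. Let $V$ be an irreducible $\mathfrak{sp}_N$-module (not assumed finite dimensional) and $\alpha,\beta\in\mathbb{C}^N$. Then $F^{\alpha,\beta}(V)$ is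 an irreducible $\mathfrak{H}_N$-module if and only if one of the following conditions holds: (i) $\dim V=\infty$; (ii) $\dim V<\infty$ and $V\not\cong V(\delta_k)$ for all $0\le k\le n$; (iii) $V\cong\mathbb{C}$ is the trivial module and $\alpha\notin\mathbb{Z}^N$. -/

import Mathlib

open scoped TensorProduct

attribute [local instance 100] LieRing.ofAssociativeRing

noncomputable section

namespace Hamiltonian

/-- The index set of the `N = 2n` coordinates: `Sum.inl i` is the `i`-th coordinate and
`Sum.inr i` is the `(n+i)`-th one. -/
abbrev Idx (n : ℕ) : Type := Fin n ⊕ Fin n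

/-- The lattice `ℤ^N`. -/
abbrev Lat (n : ℕ) : Type := Idx n → ℤ

/-- The inclusion of `ℤ^N` in `ℂ^N`. -/
def toC {n : ℕ} (r : Lat n) : Idx n → ℂ := fun i => (r i : ℂ)

/-- `r ↦ r̄ = (r_{n+1}, …, r_{2n}, -r_1, …, -r_n)`. -/
def bar {n : ℕ} (r : Idx n → ℂ) : Idx n → ℂ :=
  Sum.elim (fun i => r (Sum.inr i)) (fun i => -r (Sum.inl i))

section Elementary

variable {n : ℕ}

@[simp] lemma toC_apply (r : Lat n) (i : Idx n) : toC r i = (r i : ℂ) := rfl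

@[simp] lemma toC_zero : toC (0 : Lat n) = 0 := by ext i; simp [toC]

lemma toC_add (r s : Lat n) : toC (r + s) = toC r + toC s := by ext i; simp [toC]

lemma bar_add (r s : Idx n → ℂ) : bar (r + s) = bar r + bar s := by
  ext (i | i) <;> simp [bar, add_comm]

@[simp] lemma bar_zero : bar (0 : Idx n → ℂ) = 0 := by
  ext (i | i) <;> simp [bar]

lemma bar_dotProduct_comm (r s : Idx n → ℂ) : bar r ⬝ᵥ s = -(bar s ⬝ᵥ r) := by
  simp only [bar, dotProduct, Fintype.sum_sum_type, Sum.elim_inl, Sum.elim_inr, neg_mul,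
    Finset.sum_neg_distrib, neg_add, neg_neg]
  rw [add_comm]
  congr 1
  · rw [neg_inj]; exact Finset.sum_congr rfl fun i _ => mul_comm _ _
  · exact Finset.sum_congr rfl fun i _ => mul_comm _ _

lemma bar_dotProduct_self (r : Idx n → ℂ) : bar r ⬝ᵥ r = 0 := by
  have h := bar_dotProduct_comm r r
  linear_combination h / 2

end Elementary

/-! ### The symplectic Lie algebra -/

/-- The symplectic Lie algebra `𝔰𝔭_N` over `ℂ`, as a Lie subalgebra of `𝔤𝔩_N`. -/
abbrev sp (n : ℕ) : LieSubalgebra ℂ (Matrix (Idx n) (Idx n) ℂ) :=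
  LieAlgebra.Symplectic.sp (Fin n) ℂ

section Symplectic

variable {n : ℕ}

lemma mem_sp_iff (X : Matrix (Idx n) (Idx n) ℂ) :
    X ∈ sp n ↔ X.transpose * Matrix.J (Fin n) ℂ = -(Matrix.J (Fin n) ℂ * X) := by
  change X ∈ skewAdjointMatricesLieSubalgebra (Matrix.J (Fin n) ℂ) ↔ _
  rw [mem_skewAdjointMatricesLieSubalgebra, mem_skewAdjointMatricesSubmodule]
  simp [Matrix.IsSkewAdjoint, Matrix.IsAdjointPair, mul_neg]

/-- A block matrix `[[A, B], [C, -Aᵀ]]` with `B`, `C` symmetric lies in `𝔰𝔭_N`. -/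
lemma fromBlocks_mem_sp (A B C : Matrix (Fin n) (Fin n) ℂ)
    (hB : B.transpose = B) (hC : C.transpose = C) :
    Matrix.fromBlocks A B C (-A.transpose) ∈ sp n := by
  rw [mem_sp_iff, Matrix.J, Matrix.fromBlocks_transpose, Matrix.fromBlocks_multiply,
    Matrix.fromBlocks_multiply, Matrix.fromBlocks_neg]
  simp [hB, hC]

/-- `h_i = e_{i,i} - e_{n+i,n+i}`. -/
def cartan (i : Fin n) : sp n :=
  ⟨Matrix.fromBlocks (Matrix.single i i 1) 0 0 (-(Matrix.single i i 1).transpose),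
    fromBlocks_mem_sp _ _ _ (by simp) (by simp)⟩

/-- `X_{ε_i - ε_j} = e_{i,j} - e_{n+j,n+i}`. -/
def rootSub (i j : Fin n) : sp n :=
  ⟨Matrix.fromBlocks (Matrix.single i j 1) 0 0 (-(Matrix.single i j 1).transpose),
    fromBlocks_mem_sp _ _ _ (by simp) (by simp)⟩

/-- `X_{ε_k + ε_l} = e_{k,n+l} + e_{l,n+k}`. -/
def rootAdd (k l : Fin n) : sp n :=
  ⟨Matrix.fromBlocks 0 (Matrix.single k l 1 + Matrix.single l k 1) 0
      (-(0 : Matrix (Fin n) (Fin n) ℂ).transpose),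
    fromBlocks_mem_sp _ _ _ (by simp [add_comm]) (by simp)⟩

lemma bar_eq_J_mulVec (r : Idx n → ℂ) : bar r = -(Matrix.J (Fin n) ℂ).mulVec r := by
  ext (i | i) <;>
    simp [bar, Matrix.J, Matrix.mulVec, dotProduct, Matrix.fromBlocks, Matrix.one_apply]

/-- The matrix `r r̄ᵗ`, an element of `𝔰𝔭_N`. -/
def outer (r : Idx n → ℂ) : sp n :=
  ⟨Matrix.vecMulVec r (bar r), by
    rw [mem_sp_iff, Matrix.transpose_vecMulVec, Matrix.mul_vecMulVec, Matrix.vecMulVec_mul,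
      bar_eq_J_mulVec, ← Matrix.mulVec_transpose, Matrix.J_transpose]
    simp only [Matrix.neg_mulVec, Matrix.neg_vecMulVec, Matrix.vecMulVec_neg]⟩

lemma outer_zero : outer (0 : Idx n → ℂ) = 0 := by
  apply Subtype.ext
  simp [outer]

/-- `[r r̄ᵗ, s s̄ᵗ] + (r̄, s) (r r̄ᵗ + s s̄ᵗ) = (r̄, s) (r + s) (r̄ + s̄)ᵗ`. -/
lemma lie_outer (r s : Idx n → ℂ) :
    ⁅outer r, outer s⁆ + (bar r ⬝ᵥ s) • (outer r + outer s) =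
      (bar r ⬝ᵥ s) • outer (r + s) := by
  apply Subtype.ext
  have h := bar_dotProduct_comm s r
  change (Matrix.vecMulVec r (bar r) * Matrix.vecMulVec s (bar s) -
      Matrix.vecMulVec s (bar s) * Matrix.vecMulVec r (bar r)) +
      (bar r ⬝ᵥ s) • (Matrix.vecMulVec r (bar r) + Matrix.vecMulVec s (bar s)) =
    (bar r ⬝ᵥ s) • Matrix.vecMulVec (r + s) (bar (r + s))
  simp only [Matrix.vecMulVec_mul_vecMulVec, h, bar_add,
    Matrix.add_vecMulVec, Matrix.vecMulVec_add, Matrix.vecMulVec_smul]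
  module

end Symplectic

/-! ### Highest weight modules -/

section HighestWeight

variable {n : ℕ} (V : Type*) [AddCommGroup V] [Module ℂ V]
  [LieRingModule (sp n) V] [LieModule ℂ (sp n) V]

/-- `v` is a highest weight vector of weight `w`: it is nonzero, every positive root vector
annihilates it, and `h_i` acts on it by the scalar `w i`. Here `w i` is the coefficient of `ε_i` in
the weight. -/
structure IsHighestWeightVector (w : Fin n → ℂ) (v : V) : Prop where
  ne_zero : v ≠ 0
  rootSub_lie : ∀ i j : Fin n, i < j → ⁅rootSub i j, v⁆ = 0
  rootAdd_lie : ∀ k l : Fin n, k ≤ l → ⁅rootAdd k l, v⁆ = 0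
  cartan_lie : ∀ i : Fin n, ⁅cartan i, v⁆ = w i • v

/-- `V` is isomorphic to the irreducible `𝔰𝔭_N`-module of highest weight `w`: it is irreducible and
has a highest weight vector of weight `w`. -/
def IsIrreducibleOfHighestWeight (w : Fin n → ℂ) : Prop :=
  LieModule.IsIrreducible ℂ (sp n) V ∧ ∃ v : V, IsHighestWeightVector V w v

/-- The fundamental weight `δ_k = ε_1 + ⋯ + ε_k`, for `0 ≤ k ≤ n`, so `δ_0 = 0`. For `1 ≤ k ≤ n` it
takes the value `1` on the `k`-th simple coroot and `0` on the other ones, the simple coroots being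
`h_1 - h_2, …, h_{n-1} - h_n, h_n`. -/
def fundamentalWeight (n k : ℕ) : Fin n → ℂ := fun i => if (i : ℕ) < k then 1 else 0

/-- `V` is isomorphic to the fundamental module `V(δ_k)`, which is by definition the irreducible
`𝔰𝔭_N`-module of highest weight `δ_k`. -/
def IsFundamental (n : ℕ) (V : Type*) [AddCommGroup V] [Module ℂ V]
    [LieRingModule (sp n) V] [LieModule ℂ (sp n) V] (k : ℕ) : Prop :=
  IsIrreducibleOfHighestWeight V (fundamentalWeight n k)

end HighestWeight

/-! ### The Hamiltonian Lie algebra -/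

/-- The Laurent polynomial ring `A_N = ℂ[t_1^{±1}, …, t_N^{±1}]`, with basis `t^s`, `s ∈ ℤ^N`. -/
abbrev Laurent (n : ℕ) : Type := AddMonoidAlgebra ℂ (Lat n)

/-- The monomial `t^s`. -/
def mono {n : ℕ} (s : Lat n) : Laurent n := AddMonoidAlgebra.single s 1

/-- The basis of `A_N` formed by the monomials. -/
def monoBasis (n : ℕ) : Module.Basis (Lat n) ℂ (Laurent n) := AddMonoidAlgebra.basis (Lat n) ℂ

section Witt

variable {n : ℕ}

@[simp] lemma monoBasis_apply (s : Lat n) : monoBasis n s = mono s :=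
  AddMonoidAlgebra.basis_apply ..

lemma mono_mul (r s : Lat n) : mono r * mono s = mono (r + s) := by
  simp [mono, AddMonoidAlgebra.single_mul_single]

/-- The operator `t^s ↦ (u, s + a) t^{r+s}` on `A_N`. -/
def shift (a u : Idx n → ℂ) (r : Lat n) : Laurent n →ₗ[ℂ] Laurent n :=
  (monoBasis n).constr ℂ fun s => (u ⬝ᵥ (toC s + a)) • mono (r + s)

@[simp] lemma shift_mono (a u : Idx n → ℂ) (r s : Lat n) :
    shift a u r (mono s) = (u ⬝ᵥ (toC s + a)) • mono (r + s) := by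
  rw [shift, ← monoBasis_apply, Module.Basis.constr_basis]

/-- The derivation `D(u, r) = ∑ i, u_i t^r d_i` of `A_N`, where `d_i = t_i ∂/∂t_i`; it sends `t^s`
to `(u, s) t^{r+s}`. -/
def D (u : Idx n → ℂ) (r : Lat n) : Derivation ℂ (Laurent n) (Laurent n) :=
  Derivation.mk' (shift 0 u r) fun a b => by
    have key : (LinearMap.mul ℂ (Laurent n)).compr₂ (shift 0 u r) =
        (LinearMap.mul ℂ (Laurent n)).compl₂ (shift 0 u r) +
          (LinearMap.mul ℂ (Laurent n)).comp (shift 0 u r) := by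
      refine LinearMap.ext_basis (monoBasis n) (monoBasis n) fun p q => ?_
      simp only [monoBasis_apply, LinearMap.compr₂_apply, LinearMap.mul_apply', mono_mul,
        shift_mono, LinearMap.add_apply, LinearMap.compl₂_apply, LinearMap.comp_apply,
        mul_smul_comm, smul_mul_assoc, add_zero, toC_add, dotProduct_add]
      rw [add_left_comm p r q, add_assoc r p q]
      module
    have h := LinearMap.congr_fun (LinearMap.congr_fun key a) b
    simp only [LinearMap.compr₂_apply, LinearMap.mul_apply', LinearMap.add_apply,
      LinearMap.compl₂_apply, LinearMap.comp_apply] at h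
    rw [h, smul_eq_mul, smul_eq_mul, mul_comm b]

@[simp] lemma D_mono (u : Idx n → ℂ) (r s : Lat n) :
    D u r (mono s) = (u ⬝ᵥ toC s) • mono (r + s) := by
  change shift 0 u r (mono s) = _
  simp

lemma derivation_ext {X Y : Derivation ℂ (Laurent n) (Laurent n)}
    (h : ∀ s, X (mono s) = Y (mono s)) : X = Y := by
  have : (X : Laurent n →ₗ[ℂ] Laurent n) = Y :=
    (monoBasis n).ext fun s => by simpa using h s
  exact Derivation.ext fun a => LinearMap.congr_fun this a

/-- `[D(u, r), D(v, s)] = D((u, s) v - (v, r) u, r + s)`. -/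
lemma lie_D (u v : Idx n → ℂ) (r s : Lat n) :
    ⁅D u r, D v s⁆ = D ((u ⬝ᵥ toC s) • v - (v ⬝ᵥ toC r) • u) (r + s) := by
  refine derivation_ext fun p => ?_
  rw [Derivation.commutator_apply]
  simp only [D_mono, Derivation.map_smul, toC_add, dotProduct_add, sub_dotProduct, smul_dotProduct,
    smul_eq_mul, ← add_assoc]
  rw [add_comm s r]
  module

lemma D_zero_left (r : Lat n) : D 0 r = 0 :=
  derivation_ext fun p => by simp

lemma D_smul (c : ℂ) (u : Idx n → ℂ) (r : Lat n) : D (c • u) r = c • D u r :=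
  derivation_ext fun p => by simp [smul_smul]

/-- `H_r = D(r̄, r)`. -/
def ham (r : Lat n) : Derivation ℂ (Laurent n) (Laurent n) := D (bar (toC r)) r

/-- The degree derivation `d_i = t_i ∂/∂t_i`. -/
def deg (i : Idx n) : Derivation ℂ (Laurent n) (Laurent n) := D (Pi.single i 1) 0

@[simp] lemma ham_zero : ham (0 : Lat n) = 0 := by simp [ham, D_zero_left]

/-- `[H_r, H_s] = (r̄, s) H_{r+s}`. -/
lemma lie_ham_ham (r s : Lat n) :
    ⁅ham r, ham s⁆ = (bar (toC r) ⬝ᵥ toC s) • ham (r + s) := by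
  rw [ham, ham, lie_D, ham, ← D_smul, toC_add, bar_add, bar_dotProduct_comm (toC s)]
  congr 1
  module

lemma lie_deg_ham (i : Idx n) (r : Lat n) : ⁅deg i, ham r⁆ = (r i : ℂ) • ham r := by
  rw [ham, deg, lie_D, ← D_smul]
  simp

lemma lie_deg_deg (i j : Idx n) : ⁅deg i, deg j⁆ = 0 := by
  rw [deg, deg, lie_D]
  simp [D_zero_left]

/-- The index set of the basis `{H_r : r ≠ 0} ∪ {d_1, …, d_N}`. -/
abbrev GenIdx (n : ℕ) : Type := {r : Lat n // r ≠ 0} ⊕ Idx n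

/-- The family formed by the `H_r`, `r ≠ 0`, and the `d_i`. -/
def gen (g : GenIdx n) : Derivation ℂ (Laurent n) (Laurent n) :=
  Sum.elim (fun r => ham r.1) deg g

lemma ham_mem_span (r : Lat n) : ham r ∈ Submodule.span ℂ (Set.range (gen (n := n))) := by
  by_cases h : r = 0
  · simp [h]
  · exact Submodule.subset_span ⟨Sum.inl ⟨r, h⟩, rfl⟩

/-- The Hamiltonian Lie algebra: the span of the `H_r`, `r ≠ 0`, and of `d_1, …, d_N`, inside the
Witt algebra `W_N = Der(A_N)`. -/
def H (n : ℕ) : LieSubalgebra ℂ (Derivation ℂ (Laurent n) (Laurent n)) where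
  __ := Submodule.span ℂ (Set.range (gen (n := n)))
  lie_mem' := by
    intro x y hx hy
    change x ∈ Submodule.span ℂ (Set.range (gen (n := n))) at hx
    change y ∈ Submodule.span ℂ (Set.range (gen (n := n))) at hy
    change ⁅x, y⁆ ∈ Submodule.span ℂ (Set.range (gen (n := n)))
    induction hx, hy using Submodule.span_induction₂ with
    | mem_mem x y hx hy =>
      obtain ⟨r | i, rfl⟩ := hx <;> obtain ⟨s | j, rfl⟩ := hy <;>
        simp only [gen, Sum.elim_inl, Sum.elim_inr]
      · rw [lie_ham_ham]; exact Submodule.smul_mem _ _ (ham_mem_span _)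
      · rw [← lie_skew, lie_deg_ham]
        exact Submodule.neg_mem _ (Submodule.smul_mem _ _ (ham_mem_span _))
      · rw [lie_deg_ham]; exact Submodule.smul_mem _ _ (ham_mem_span _)
      · rw [lie_deg_deg]; exact Submodule.zero_mem _
    | zero_left y _ =>
      have e : ⁅(0 : Derivation ℂ (Laurent n) (Laurent n)), y⁆ = 0 := zero_lie y
      rw [e]; exact Submodule.zero_mem _
    | zero_right x _ =>
      have e : ⁅x, (0 : Derivation ℂ (Laurent n) (Laurent n))⁆ = 0 := lie_zero x
      rw [e]; exact Submodule.zero_mem _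
    | add_left x y z _ _ _ hx hy =>
      have e : ⁅x + y, z⁆ = ⁅x, z⁆ + ⁅y, z⁆ := add_lie x y z
      rw [e]; exact Submodule.add_mem _ hx hy
    | add_right x y z _ _ _ hx hy =>
      have e : ⁅x, y + z⁆ = ⁅x, y⁆ + ⁅x, z⁆ := lie_add x y z
      rw [e]; exact Submodule.add_mem _ hx hy
    | smul_left c x y _ _ h =>
      have e : ⁅c • x, y⁆ = c • ⁅x, y⁆ := smul_lie c x y
      rw [e]; exact Submodule.smul_mem _ _ h
    | smul_right c x y _ _ h =>
      have e : ⁅x, c • y⁆ = c • ⁅x, y⁆ := lie_smul c x y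
      rw [e]; exact Submodule.smul_mem _ _ h

/-- The coefficient of `t^{p + e_j}` in `X(t_j)`. -/
def coeffAt (p : Lat n) (j : Idx n) : Derivation ℂ (Laurent n) (Laurent n) →ₗ[ℂ] ℂ where
  toFun X := (monoBasis n).coord (p + Pi.single j 1) (X (mono (Pi.single j 1)))
  map_add' X Y := by simp
  map_smul' c X := by simp

lemma coeffAt_D (p r : Lat n) (j : Idx n) (u : Idx n → ℂ) :
    coeffAt p j (D u r) = if r = p then u j else 0 := by
  have h : toC (Pi.single j 1 : Lat n) = Pi.single j 1 := by
    ext i; by_cases hi : i = j <;> simp [hi]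
  change (monoBasis n).coord (p + Pi.single j 1) (D u r (mono (Pi.single j 1))) = _
  rw [D_mono, ← monoBasis_apply, map_smul, Module.Basis.coord_apply, Module.Basis.repr_self,
    Finsupp.single_apply, h]
  simp

lemma bar_toC_ne_zero {r : Lat n} (h : r ≠ 0) : ∃ j, bar (toC r) j ≠ 0 := by
  obtain ⟨i | i, hi⟩ := Function.ne_iff.mp h
  · exact ⟨Sum.inr i, by simpa [bar] using hi⟩
  · exact ⟨Sum.inl i, by simpa [bar] using hi⟩

lemma linearIndependent_gen : LinearIndependent ℂ (gen (n := n)) := by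
  classical
  refine LinearIndependent.of_pairwise_dual_eq_zero_one (gen (n := n))
    (fun g => match g with
      | Sum.inl r => (bar (toC r.1) (bar_toC_ne_zero r.2).choose)⁻¹ •
          coeffAt r.1 (bar_toC_ne_zero r.2).choose
      | Sum.inr i => coeffAt 0 i) ?_ ?_
  · rintro (r | i) (s | j) hne
    · have : s.1 ≠ r.1 := fun h => hne (by rw [Subtype.ext h])
      simp [gen, ham, coeffAt_D, this]
    · simp [gen, deg, coeffAt_D, r.2.symm]
    · simp [gen, ham, coeffAt_D, s.2]
    · have : i ≠ j := fun h => hne (by rw [h])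
      simp [gen, deg, coeffAt_D, this]
  · rintro (r | i)
    · simp [gen, ham, coeffAt_D, (bar_toC_ne_zero r.2).choose_spec]
    · simp [gen, deg, coeffAt_D]

/-- The basis `{H_r : r ≠ 0} ∪ {d_1, …, d_N}` of the Hamiltonian Lie algebra. -/
def basisH (n : ℕ) : Module.Basis (GenIdx n) ℂ (H n) :=
  Module.Basis.span (linearIndependent_gen (n := n))

lemma coe_basisH (g : GenIdx n) : (basisH n g : Derivation ℂ (Laurent n) (Laurent n)) = gen g :=
  Module.Basis.coe_span_apply linearIndependent_gen g

/-- `H_r` as an element of the Hamiltonian Lie algebra (`H_0 = 0`). -/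
def hamH (r : Lat n) : H n := ⟨ham r, ham_mem_span r⟩

/-- `d_i` as an element of the Hamiltonian Lie algebra. -/
def degH (i : Idx n) : H n := ⟨deg i, Submodule.subset_span ⟨Sum.inr i, rfl⟩⟩

lemma basisH_inl (r : {r : Lat n // r ≠ 0}) : basisH n (Sum.inl r) = hamH r.1 :=
  Subtype.ext (coe_basisH _)

lemma basisH_inr (i : Idx n) : basisH n (Sum.inr i) = degH i :=
  Subtype.ext (coe_basisH _)

lemma hamH_zero : hamH (0 : Lat n) = 0 := Subtype.ext ham_zero

lemma lie_hamH_hamH (r s : Lat n) :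
    ⁅hamH r, hamH s⁆ = (bar (toC r) ⬝ᵥ toC s) • hamH (r + s) :=
  Subtype.ext (lie_ham_ham r s)

lemma lie_degH_hamH (i : Idx n) (r : Lat n) : ⁅degH i, hamH r⁆ = (r i : ℂ) • hamH r :=
  Subtype.ext (lie_deg_ham i r)

lemma lie_degH_degH (i j : Idx n) : ⁅degH i, degH j⁆ = 0 :=
  Subtype.ext (lie_deg_deg i j)

end Witt

/-! ### The Shen-Larsson functor -/

section ShenLarsson

variable {n : ℕ} (α β : Idx n → ℂ) (V : Type*) [AddCommGroup V] [Module ℂ V]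

/-- The operator by which `d_i` acts on `V ⊗ A_N`: `v ⊗ t^s ↦ (s_i + β_i) v ⊗ t^s`. -/
def degOp (i : Idx n) : Module.End ℂ (V ⊗[ℂ] Laurent n) :=
  TensorProduct.map LinearMap.id (shift β (Pi.single i 1) 0)

lemma degOp_tmul (i : Idx n) (s : Lat n) (v : V) :
    degOp β V i (v ⊗ₜ mono s) = ((s i : ℂ) + β i) • (v ⊗ₜ mono s) := by
  simp [degOp]

variable {V} in
lemma end_ext {f g : Module.End ℂ (V ⊗[ℂ] Laurent n)}
    (h : ∀ (v : V) (s : Lat n), f (v ⊗ₜ mono s) = g (v ⊗ₜ mono s)) : f = g := by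
  refine TensorProduct.ext (LinearMap.ext fun v => (monoBasis n).ext fun s => ?_)
  simpa using h v s

lemma lie_degOp_degOp (i j : Idx n) : ⁅degOp β V i, degOp β V j⁆ = 0 := by
  refine end_ext fun v p => ?_
  rw [LieRing.of_associative_ring_bracket]
  simp only [LinearMap.sub_apply, Module.End.mul_apply, degOp_tmul, map_smul, LinearMap.zero_apply]
  module

variable [LieRingModule (sp n) V] [LieModule ℂ (sp n) V]

/-- The operator by which `H_r` acts on `V ⊗ A_N`:
`v ⊗ t^s ↦ ((r̄, s + α) I + r r̄ᵗ) v ⊗ t^{r+s}`. -/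
def hamOp (r : Lat n) : Module.End ℂ (V ⊗[ℂ] Laurent n) :=
  TensorProduct.map LinearMap.id (shift α (bar (toC r)) r) +
    TensorProduct.map (LieModule.toEnd ℂ (sp n) V (outer (toC r)))
      (LinearMap.mulLeft ℂ (mono r))

lemma hamOp_tmul (r s : Lat n) (v : V) :
    hamOp α V r (v ⊗ₜ mono s) =
      ((bar (toC r) ⬝ᵥ (toC s + α)) • v + ⁅outer (toC r), v⁆) ⊗ₜ mono (r + s) := by
  simp [hamOp, mono_mul, TensorProduct.add_tmul, TensorProduct.smul_tmul']

lemma hamOp_zero : hamOp α V (0 : Lat n) = 0 := by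
  have h : shift α 0 (0 : Lat n) = 0 := (monoBasis n).ext fun s => by simp
  simp [hamOp, outer_zero, h]

lemma lie_hamOp_hamOp (r s : Lat n) :
    ⁅hamOp α V r, hamOp α V s⁆ = (bar (toC r) ⬝ᵥ toC s) • hamOp α V (r + s) := by
  refine end_ext fun v p => ?_
  have h1 := congrArg (fun X : sp n => ⁅X, v⁆) (lie_outer (toC r) (toC s))
  have h2 := bar_dotProduct_comm (toC s) (toC r)
  simp only [add_lie, smul_lie, lie_lie] at h1
  rw [LieRing.of_associative_ring_bracket]
  simp only [LinearMap.sub_apply, Module.End.mul_apply, LinearMap.smul_apply, hamOp_tmul,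
    lie_add, lie_smul, toC_add, bar_add, dotProduct_add, add_dotProduct, h2, ← add_assoc]
  rw [add_comm s r, ← TensorProduct.sub_tmul, TensorProduct.smul_tmul']
  congr 1
  refine sub_eq_zero.mp (Eq.trans ?_ (sub_eq_zero.mpr h1))
  module

lemma lie_degOp_hamOp (i : Idx n) (r : Lat n) :
    ⁅degOp β V i, hamOp α V r⁆ = (r i : ℂ) • hamOp α V r := by
  refine end_ext fun v p => ?_
  rw [LieRing.of_associative_ring_bracket]
  simp only [LinearMap.sub_apply, Module.End.mul_apply, LinearMap.smul_apply, hamOp_tmul,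
    degOp_tmul, map_smul]
  rw [← sub_smul]
  congr 1
  simp

/-- The linear extension of `H_r ↦ hamOp r`, `d_i ↦ degOp i`. -/
def actionLin : H n →ₗ[ℂ] Module.End ℂ (V ⊗[ℂ] Laurent n) :=
  (basisH n).constr ℂ (Sum.elim (fun r => hamOp α V r.1) (degOp β V))

lemma actionLin_hamH (r : Lat n) : actionLin α β V (hamH r) = hamOp α V r := by
  by_cases h : r = 0
  · rw [h, hamH_zero, map_zero, hamOp_zero]
  · rw [← basisH_inl ⟨r, h⟩, actionLin, Module.Basis.constr_basis, Sum.elim_inl]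

lemma actionLin_degH (i : Idx n) : actionLin α β V (degH i) = degOp β V i := by
  rw [← basisH_inr, actionLin, Module.Basis.constr_basis, Sum.elim_inr]

/-- The representation of the Hamiltonian Lie algebra on `V ⊗ A_N` with parameters `α`, `β`. -/
def action : H n →ₗ⁅ℂ⁆ Module.End ℂ (V ⊗[ℂ] Laurent n) where
  __ := actionLin α β V
  map_lie' := by
    intro x y
    change actionLin α β V ⁅x, y⁆ = ⁅actionLin α β V x, actionLin α β V y⁆
    have key : (LieModule.toEnd ℂ (H n) (H n) : H n →ₗ[ℂ] Module.End ℂ (H n)).compr₂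
          (actionLin α β V) =
        (LieModule.toEnd ℂ (Module.End ℂ (V ⊗[ℂ] Laurent n))
          (Module.End ℂ (V ⊗[ℂ] Laurent n)) :
            Module.End ℂ (V ⊗[ℂ] Laurent n) →ₗ[ℂ] _).compl₁₂
          (actionLin α β V) (actionLin α β V) := by
      refine LinearMap.ext_basis (basisH n) (basisH n) ?_
      rintro (r | i) (s | j) <;>
        simp only [basisH_inl, basisH_inr, LinearMap.compr₂_apply, LinearMap.compl₁₂_apply,
          LieHom.coe_toLinearMap, LieModule.toEnd_apply_apply, actionLin_hamH, actionLin_degH]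
      · rw [lie_hamH_hamH, map_smul, actionLin_hamH, lie_hamOp_hamOp]
      · rw [← lie_skew, lie_degH_hamH, ← lie_skew (hamOp α V r.1), lie_degOp_hamOp, map_neg,
          map_smul, actionLin_hamH]
      · rw [lie_degH_hamH, map_smul, actionLin_hamH, lie_degOp_hamOp]
      · rw [lie_degH_degH, map_zero, lie_degOp_degOp]
    exact LinearMap.congr_fun (LinearMap.congr_fun key x) y

/-- The module `F^{α,β}(V) = V ⊗ A_N` over the Hamiltonian Lie algebra. -/
@[nolint unusedArguments]
def F (_α _β : Idx n → ℂ) (V : Type*) [AddCommGroup V] [Module ℂ V] : Type _ :=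
  V ⊗[ℂ] Laurent n

instance : AddCommGroup (F α β V) := inferInstanceAs (AddCommGroup (V ⊗[ℂ] Laurent n))

instance : Module ℂ (F α β V) := inferInstanceAs (Module ℂ (V ⊗[ℂ] Laurent n))

/-- The vector `v ⊗ t^s` of `F^{α,β}(V)`. -/
def F.tmul {V : Type*} [AddCommGroup V] [Module ℂ V] (v : V) (s : Lat n) : F α β V :=
  v ⊗ₜ[ℂ] mono s

instance : LieRingModule (H n) (F α β V) :=
  LieRingModule.compLieHom (V ⊗[ℂ] Laurent n) (action α β V)

instance : LieModule ℂ (H n) (F α β V) :=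
  LieModule.compLieHom (V ⊗[ℂ] Laurent n) (action α β V)

variable {V}

/-- `H_r (v ⊗ t^s) = ((r̄, s + α) I + r r̄ᵗ) v ⊗ t^{r+s}`. -/
lemma hamH_lie_tmul (r s : Lat n) (v : V) :
    ⁅hamH r, F.tmul α β v s⁆ =
      F.tmul α β ((bar (toC r) ⬝ᵥ (toC s + α)) • v + ⁅outer (toC r), v⁆) (r + s) := by
  change actionLin α β V (hamH r) (v ⊗ₜ[ℂ] mono s) = _
  rw [actionLin_hamH, hamOp_tmul]
  rfl

/-- `d_i (v ⊗ t^s) = (s_i + β_i) v ⊗ t^s`. -/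
lemma degH_lie_tmul (i : Idx n) (s : Lat n) (v : V) :
    ⁅degH i, F.tmul α β v s⁆ = ((s i : ℂ) + β i) • F.tmul α β v s := by
  change actionLin α β V (degH i) (v ⊗ₜ[ℂ] mono s) = _
  rw [actionLin_degH, degOp_tmul]
  rfl

end ShenLarsson

end Hamiltonian

end

/-! Everything turns on one property of `V`, `OuterSqZero`: every long root element r r̄ᵗ acts with
square zero.

If it fails, no nonzero vector is killed by all these squares, because the vectors that are killed
form an 𝔰𝔭_N-submodule (`outerSqKer`). For v ⊗ t^s in a nonzero submodule, H_{m-kq} H_{kq} (v ⊗ t^s)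
has degree m + s independent of k and is a polynomial in k with leading coefficient (q q̄ᵗ)² v. So
this vector lies in every fiber (`doubleCoeff_mem_fiber`). The intersection of all fibers is an
𝔰𝔭_N-submodule, hence all of V, and F^{α,β}(V) is irreducible (`isIrreducible_of_not_outerSqZero`).

If it holds, the kernels of the elements attached to s + α, placed in degree s, form a graded
submodule, which is proper and nonzero unless 𝔰𝔭_N acts by zero (`OuterSqZero.not_isIrreducible`).
For trivial action, H_r merely scales by (r̄, s + α) while shifting the degree, and only a degree
with s + α = 0 obstructs irreducibility (`isIrreducible_iff_of_trivial`).

It remains to identify the property with being some V(δ_k). It forces finite dimension by a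
pigeonhole argument on words (`finiteDimensional_of_lie_lie_eq_zero`) and weights with entries in
{-1, 0, 1}, so that the highest one is some δ_k (`OuterSqZero.exists_isFundamental`). Conversely, in
a finite-dimensional V(δ_k) the squares kill a highest weight vector
(`IsHighestWeightVector.mem_outerSqKer`). -/

noncomputable section

namespace Hamiltonian

/-! ### Polynomials with vector coefficients -/

section VectorPolynomial

variable {W : Type*} [AddCommGroup W] [Module ℂ W]

/-- If a polynomial with vector coefficients takes values in a subspace at infinitely many points,
its coefficients lie in the subspace. -/
lemma coeff_mem_of_infinite (p : Submodule ℂ W) {S : Set ℂ} (hS : S.Infinite) (d : ℕ) (c : ℕ → W)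
    (h : ∀ t ∈ S, ∑ i ∈ Finset.range d, t ^ i • c i ∈ p) {i : ℕ} (hi : i < d) : c i ∈ p := by
  rw [← Submodule.Quotient.mk_eq_zero, ← Module.forall_dual_apply_eq_zero_iff ℂ]
  intro φ
  set P : Polynomial ℂ :=
    ∑ j ∈ Finset.range d, Polynomial.C (φ (p.mkQ (c j))) * Polynomial.X ^ j with hP
  have hP0 : P = 0 := by
    refine Polynomial.eq_zero_of_infinite_isRoot P (hS.mono fun t ht => ?_)
    have h1 := (Submodule.Quotient.mk_eq_zero p).mpr (h t ht)
    have h2 := congrArg φ h1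
    rw [← Submodule.mkQ_apply, map_sum, map_sum, map_zero] at h2
    simp only [Set.mem_ofPred_eq, Polynomial.IsRoot, hP, Polynomial.eval_finsetSum,
      Polynomial.eval_mul, Polynomial.eval_C, Polynomial.eval_pow, Polynomial.eval_X]
    rw [← h2]
    exact Finset.sum_congr rfl fun j _ => by simp [mul_comm]
  have h3 := congrArg (fun q => Polynomial.coeff q i) hP0
  simpa [hP, Polynomial.finsetSum_coeff, Polynomial.coeff_C_mul, Polynomial.coeff_X_pow, hi]
    using h3

lemma infinite_range_intCast : (Set.range ((↑) : ℤ → ℂ)).Infinite :=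
  Set.infinite_range_of_injective Int.cast_injective

/-- The functions that are polynomial of degree less than `d` in every coordinate. -/
def IsCoordPolynomial {ι : Type*} [DecidableEq ι] (d : ℕ) (f : (ι → ℂ) → W) : Prop :=
  ∀ (r : ι → ℂ) (i : ι), ∃ c : ℕ → W, ∀ t : ℂ,
    f (r + t • Pi.single i 1) = ∑ j ∈ Finset.range d, t ^ j • c j

/-- A polynomial function that vanishes on `ℤ^N` is zero. -/
lemma IsCoordPolynomial.eq_zero {n d : ℕ} {f : (Idx n → ℂ) → W} (hf : IsCoordPolynomial d f)
    (h : ∀ r : Lat n, f (toC r) = 0) (r : Idx n → ℂ) : f r = 0 := by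
  -- `S` collects the coordinates allowed to be non-integral; they are freed one at a time, the
  -- others staying integral.
  suffices H : ∀ (S : Finset (Idx n)) (r : Idx n → ℂ),
      (∀ i ∉ S, ∃ k : ℤ, r i = k) → f r = 0 from H Finset.univ r (by simp)
  intro S
  induction S using Finset.induction_on with
  | empty =>
    intro r hr
    choose k hk using fun i => hr i (by simp)
    rw [show r = toC k from funext hk]
    exact h k
  | insert i S _ ih =>
    intro r hr
    obtain ⟨c, hc⟩ := hf (r - r i • Pi.single i 1) i
    have key : ∀ j < d, c j = 0 := fun j hj => by
      refine (Submodule.mem_bot ℂ).mp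
        (coeff_mem_of_infinite ⊥ infinite_range_intCast d c ?_ hj)
      rintro _ ⟨k, rfl⟩
      rw [Submodule.mem_bot, ← hc]
      refine ih _ fun j hj => ?_
      by_cases hji : j = i
      · subst hji; exact ⟨k, by simp⟩
      · obtain ⟨m, hm⟩ := hr j (by simp [hji, hj])
        exact ⟨m, by simp [hji, hm]⟩
    have := hc (r i)
    rw [sub_add_cancel] at this
    rw [this]
    exact Finset.sum_eq_zero fun j hj => by rw [key j (Finset.mem_range.mp hj), smul_zero]

end VectorPolynomial

/-! ### The elements `r s̄ᵗ + s r̄ᵗ` of the symplectic Lie algebra -/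

section OuterPolarization

variable {n : ℕ}

lemma bar_smul (c : ℂ) (r : Idx n → ℂ) : bar (c • r) = c • bar r := by
  ext (i | i) <;> simp [bar]

lemma bar_neg (r : Idx n → ℂ) : bar (-r) = -bar r := by
  ext (i | i) <;> simp [bar]

lemma bar_bar (r : Idx n → ℂ) : bar (bar r) = -r := by
  ext (i | i) <;> simp [bar]

lemma sp_coe_add (x y : sp n) : (x + y).1 = x.1 + y.1 := rfl

lemma sp_coe_sub (x y : sp n) : (x - y).1 = x.1 - y.1 := rfl

lemma sp_coe_neg (x : sp n) : (-x).1 = -x.1 := rfl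

lemma sp_coe_smul (c : ℂ) (x : sp n) : (c • x).1 = c • x.1 := rfl

lemma coe_outer (r : Idx n → ℂ) : (outer r).1 = Matrix.vecMulVec r (bar r) := rfl

/-- The polarization `r s̄ᵗ + s r̄ᵗ` of `r r̄ᵗ`. -/
def outer₂ : (Idx n → ℂ) →ₗ[ℂ] (Idx n → ℂ) →ₗ[ℂ] sp n :=
  LinearMap.mk₂ ℂ (fun r s => outer (r + s) - outer r - outer s)
    (fun r r' s => Subtype.ext <| by
      simp only [sp_coe_sub, sp_coe_add, coe_outer, bar_add,
        Matrix.add_vecMulVec, Matrix.vecMulVec_add]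
      abel)
    (fun c r s => Subtype.ext <| by
      simp only [sp_coe_sub, sp_coe_smul, coe_outer, bar_add, bar_smul,
        Matrix.add_vecMulVec, Matrix.vecMulVec_add, Matrix.smul_vecMulVec, Matrix.vecMulVec_smul]
      module)
    (fun r s s' => Subtype.ext <| by
      simp only [sp_coe_sub, sp_coe_add, coe_outer, bar_add,
        Matrix.add_vecMulVec, Matrix.vecMulVec_add]
      abel)
    (fun c r s => Subtype.ext <| by
      simp only [sp_coe_sub, sp_coe_smul, coe_outer, bar_add, bar_smul,
        Matrix.add_vecMulVec, Matrix.vecMulVec_add, Matrix.smul_vecMulVec, Matrix.vecMulVec_smul]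
      module)

lemma outer₂_apply (r s : Idx n → ℂ) : outer₂ r s = outer (r + s) - outer r - outer s := rfl

lemma coe_outer₂ (r s : Idx n → ℂ) :
    (outer₂ r s).1 = Matrix.vecMulVec r (bar s) + Matrix.vecMulVec s (bar r) := by
  simp only [outer₂_apply, sp_coe_sub, coe_outer, bar_add,
    Matrix.add_vecMulVec, Matrix.vecMulVec_add]
  abel

lemma outer₂_comm (r s : Idx n → ℂ) : outer₂ r s = outer₂ s r := by
  rw [outer₂_apply, outer₂_apply, add_comm r s]; abel

lemma outer_add (r s : Idx n → ℂ) : outer (r + s) = outer r + outer₂ r s + outer s := by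
  rw [outer₂_apply]; abel

lemma outer_smul (c : ℂ) (r : Idx n → ℂ) : outer (c • r) = c ^ 2 • outer r := by
  apply Subtype.ext
  rw [sp_coe_smul, coe_outer, coe_outer, bar_smul, Matrix.smul_vecMulVec,
    Matrix.vecMulVec_smul, smul_smul, pow_two]

lemma outer₂_self (r : Idx n → ℂ) : outer₂ r r = (2 : ℂ) • outer r := by
  rw [outer₂_apply, ← two_smul ℂ r, outer_smul]; module

lemma outer_sub (r s : Idx n → ℂ) : outer (r - s) = outer r - outer₂ r s + outer s := by
  rw [sub_eq_add_neg, outer_add, ← neg_one_smul ℂ s, outer_smul, map_smul]; module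

lemma outer_mulVec (r s : Idx n → ℂ) : (outer r).1.mulVec s = (bar r ⬝ᵥ s) • r := by
  rw [coe_outer, Matrix.vecMulVec_mulVec]; ext; simp [mul_comm]

lemma outer₂_mulVec (a b r : Idx n → ℂ) :
    (outer₂ a b).1.mulVec r = (bar b ⬝ᵥ r) • a + (bar a ⬝ᵥ r) • b := by
  rw [coe_outer₂, Matrix.add_mulVec, Matrix.vecMulVec_mulVec, Matrix.vecMulVec_mulVec]
  ext; simp [mul_comm]

/-- Infinitesimal invariance of the symplectic form (r̄, s), read as an identity of row vectors. -/
lemma bar_mulVec (x : sp n) (r : Idx n → ℂ) :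
    bar (x.1.mulVec r) = -Matrix.vecMul (bar r) x.1 := by
  have hx := (mem_sp_iff x.1).mp x.2
  rw [bar_eq_J_mulVec, Matrix.mulVec_mulVec, ← neg_eq_iff_eq_neg.mpr hx, Matrix.neg_mulVec,
    ← Matrix.mulVec_mulVec, Matrix.mulVec_transpose, bar_eq_J_mulVec, Matrix.neg_vecMul]

/-- The identification of 𝔰𝔭_N with the symmetric square of ℂ^N is equivariant. All later brackets
are computed through this. -/
lemma lie_outer₂ (x : sp n) (r s : Idx n → ℂ) :
    ⁅x, outer₂ r s⁆ = outer₂ (x.1.mulVec r) s + outer₂ r (x.1.mulVec s) := by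
  apply Subtype.ext
  change x.1 * (outer₂ r s).1 - (outer₂ r s).1 * x.1 = _
  simp only [sp_coe_add, coe_outer₂, mul_add, add_mul, Matrix.mul_vecMulVec,
    Matrix.vecMulVec_mul, bar_mulVec, Matrix.vecMulVec_neg]
  abel

lemma lie_outer_right (x : sp n) (r : Idx n → ℂ) : ⁅x, outer r⁆ = outer₂ (x.1.mulVec r) r := by
  have h := lie_outer₂ x r r
  rw [outer₂_self, lie_smul, outer₂_comm r] at h
  have h2 : (2 : ℂ) • ⁅x, outer r⁆ = (2 : ℂ) • outer₂ (x.1.mulVec r) r := by rw [h]; module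
  exact smul_right_injective _ (two_ne_zero : (2 : ℂ) ≠ 0) h2

/-- The unit vectors of `ℂ^N`. -/
def unit (i : Idx n) : Idx n → ℂ := Pi.single i 1

lemma unit_apply (i j : Idx n) : unit i j = if j = i then 1 else 0 := Pi.single_apply _ _ _

lemma toC_single (i : Idx n) : toC (Pi.single i 1 : Lat n) = unit i := by
  ext j; by_cases h : j = i <;> simp [unit, h]

lemma sum_smul_unit (r : Idx n → ℂ) : r = ∑ i, r i • unit i := by
  ext j; simp [unit, Finset.sum_apply, Pi.single_apply]

@[simp] lemma bar_unit_inl (i : Fin n) : bar (unit (Sum.inl i)) = -unit (Sum.inr i) := by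
  ext (j | j) <;> simp [bar, unit, Pi.single_apply]

@[simp] lemma bar_unit_inr (i : Fin n) : bar (unit (Sum.inr i)) = unit (Sum.inl i) := by
  ext (j | j) <;> simp [bar, unit, Pi.single_apply]

@[simp] lemma unit_dotProduct (i : Idx n) (r : Idx n → ℂ) : unit i ⬝ᵥ r = r i := by
  simp [unit]

/-- `2x = ∑ i, (x e_i, e'_i)` where `e'_i` is the dual basis. -/
lemma sum_outer₂ (x : sp n) :
    ∑ i, outer₂ (x.1.mulVec (unit i)) (-bar (unit i)) = (2 : ℂ) • x := by
  have h1 : ∑ i : Idx n, Matrix.vecMulVec (unit i) (unit i) = (1 : Matrix (Idx n) (Idx n) ℂ) := by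
    ext j k
    simp [Matrix.sum_apply, Matrix.vecMulVec_apply, unit, Matrix.one_apply, Pi.single_apply]
  have h2 : ∑ i : Idx n, Matrix.vecMulVec (bar (unit i)) (bar (unit i)) =
      (1 : Matrix (Idx n) (Idx n) ℂ) := by
    rw [← h1, Fintype.sum_sum_type, Fintype.sum_sum_type, add_comm]
    simp [Matrix.neg_vecMulVec, Matrix.vecMulVec_neg]
  -- Invariance of the form moves `x` to the right in the second summand, so each of the two sums is
  -- `x` times a resolution of the identity.
  have hterm : ∀ i : Idx n, (outer₂ (x.1.mulVec (unit i)) (-bar (unit i))).1 =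
      x.1 * Matrix.vecMulVec (unit i) (unit i) +
        Matrix.vecMulVec (bar (unit i)) (bar (unit i)) * x.1 := by
    intro i
    rw [coe_outer₂, bar_neg, bar_bar, neg_neg, bar_mulVec, Matrix.vecMulVec_neg,
      Matrix.neg_vecMulVec, neg_neg, Matrix.mul_vecMulVec, Matrix.vecMulVec_mul]
  apply Subtype.ext
  rw [sp_coe_smul, two_smul]
  change (sp n).toSubmodule.subtype (∑ i, _) = _
  rw [map_sum]
  change ∑ i, (outer₂ (x.1.mulVec (unit i)) (-bar (unit i))).1 = _
  rw [Finset.sum_congr rfl fun i _ => hterm i, Finset.sum_add_distrib, ← Finset.mul_sum,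
    ← Finset.sum_mul, h1, h2, mul_one, one_mul]

/-- `𝔰𝔭_N` is spanned by the elements `r r̄ᵗ` where `r = e_i + e_j`. -/
lemma span_outer_unit_add :
    Submodule.span ℂ (Set.range fun p : Idx n × Idx n => outer (unit p.1 + unit p.2)) = ⊤ := by
  set P := Submodule.span ℂ (Set.range fun p : Idx n × Idx n => outer (unit p.1 + unit p.2))
  have hP : ∀ i j, outer (unit i + unit j) ∈ P := fun i j => Submodule.subset_span ⟨(i, j), rfl⟩
  have hu : ∀ i, outer (unit i) ∈ P := fun i => by
    -- The diagonal pair gives r = 2e_i, and `outer` is quadratic.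
    have h := P.smul_mem (4⁻¹ : ℂ) (hP i i)
    rw [← two_smul ℂ (unit i), outer_smul, smul_smul] at h
    norm_num at h
    exact h
  have h2 : ∀ r s : Idx n → ℂ, outer₂ r s ∈ P := fun r s => by
    rw [sum_smul_unit r, sum_smul_unit s]
    simp only [map_sum, LinearMap.sum_apply, map_smul, LinearMap.smul_apply]
    refine P.sum_mem fun i _ => P.smul_mem _ (P.sum_mem fun j _ => P.smul_mem _ ?_)
    rw [outer₂_apply]
    exact P.sub_mem (P.sub_mem (hP _ _) (hu _)) (hu _)
  refine eq_top_iff.mpr fun x _ => ?_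
  have := P.smul_mem (2⁻¹ : ℂ) (P.sum_mem fun i (_ : i ∈ Finset.univ) =>
    h2 (x.1.mulVec (unit i)) (-bar (unit i)))
  rwa [sum_outer₂, smul_smul, inv_mul_cancel₀ two_ne_zero, one_smul] at this

lemma span_outer_toC :
    Submodule.span ℂ (Set.range fun r : Lat n => outer (toC r)) = ⊤ := by
  refine eq_top_iff.mpr (span_outer_unit_add.ge.trans (Submodule.span_mono ?_))
  rintro _ ⟨p, rfl⟩
  exact ⟨Pi.single p.1 1 + Pi.single p.2 1, by simp only [toC_add, toC_single]⟩

lemma cartan_eq_outer₂ (i : Fin n) :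
    cartan i = outer₂ (unit (Sum.inl i)) (unit (Sum.inr i)) := by
  apply Subtype.ext
  rw [coe_outer₂, bar_unit_inl, bar_unit_inr]
  ext (j | j) (k | k) <;>
    simp [cartan, Matrix.vecMulVec_apply, unit, Matrix.single_apply, Pi.single_apply] <;> grind

lemma rootSub_eq_outer₂ (i j : Fin n) :
    rootSub i j = outer₂ (unit (Sum.inl i)) (unit (Sum.inr j)) := by
  apply Subtype.ext
  rw [coe_outer₂, bar_unit_inl, bar_unit_inr]
  ext (k | k) (l | l) <;>
    simp [rootSub, Matrix.vecMulVec_apply, unit, Matrix.single_apply, Pi.single_apply] <;> grind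

lemma rootAdd_eq_outer₂ (k l : Fin n) :
    rootAdd k l = -outer₂ (unit (Sum.inl k)) (unit (Sum.inl l)) := by
  apply Subtype.ext
  rw [sp_coe_neg, coe_outer₂, bar_unit_inl, bar_unit_inl]
  ext (i | i) (j | j)
  all_goals
    simp [rootAdd, Matrix.vecMulVec_apply, unit, Matrix.single_apply, Pi.single_apply]
  grind

end OuterPolarization

/-! ### Modules on which the long root vectors square to zero -/

section OuterSquare

variable {n : ℕ} {V : Type*} [AddCommGroup V] [Module ℂ V]
  [LieRingModule (sp n) V] [LieModule ℂ (sp n) V]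

lemma outer_add_smul (r s : Idx n → ℂ) (t : ℂ) :
    outer (r + t • s) = outer r + t • outer₂ r s + t ^ 2 • outer s := by
  rw [outer_add, outer_smul, map_smul]

lemma isCoordPolynomial_outer (v : V) :
    IsCoordPolynomial 3 fun r : Idx n → ℂ => ⁅outer r, v⁆ := fun r i =>
  ⟨fun j => match j with
    | 0 => ⁅outer r, v⁆
    | 1 => ⁅outer₂ r (Pi.single i 1), v⁆
    | _ => ⁅outer (Pi.single i 1), v⁆, fun t => by
    simp only [outer_add_smul, add_lie, smul_lie, Finset.sum_range_succ, Finset.sum_range_zero]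
    module⟩

/-- The coefficients of the polynomial `t ↦ (outer (r + t s))² v`. -/
def outerSqCoeff (r s : Idx n → ℂ) (v : V) : ℕ → V
  | 0 => ⁅outer r, ⁅outer r, v⁆⁆
  | 1 => ⁅outer r, ⁅outer₂ r s, v⁆⁆ + ⁅outer₂ r s, ⁅outer r, v⁆⁆
  | 2 => ⁅outer r, ⁅outer s, v⁆⁆ + ⁅outer₂ r s, ⁅outer₂ r s, v⁆⁆ + ⁅outer s, ⁅outer r, v⁆⁆
  | 3 => ⁅outer₂ r s, ⁅outer s, v⁆⁆ + ⁅outer s, ⁅outer₂ r s, v⁆⁆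
  | _ => ⁅outer s, ⁅outer s, v⁆⁆

lemma outer_sq_add_smul (r s : Idx n → ℂ) (t : ℂ) (v : V) :
    ⁅outer (r + t • s), ⁅outer (r + t • s), v⁆⁆ =
      ∑ j ∈ Finset.range 5, t ^ j • outerSqCoeff r s v j := by
  simp only [outer_add_smul, add_lie, smul_lie, lie_add, lie_smul, Finset.sum_range_succ,
    Finset.sum_range_zero, outerSqCoeff]
  module

lemma isCoordPolynomial_outer_sq (v : V) :
    IsCoordPolynomial 5 fun r : Idx n → ℂ => ⁅outer r, ⁅outer r, v⁆⁆ := fun r i =>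
  ⟨outerSqCoeff r (Pi.single i 1) v, fun t => outer_sq_add_smul r _ t v⟩

/-- Polarization: this is the coefficient of t in the identically vanishing quartic t ↦ (outer (r +
ts))² v. -/
lemma lie_outer_outer₂_add {v : V} (hv : ∀ r : Idx n → ℂ, ⁅outer r, ⁅outer r, v⁆⁆ = 0)
    (r s : Idx n → ℂ) : ⁅outer r, ⁅outer₂ r s, v⁆⁆ + ⁅outer₂ r s, ⁅outer r, v⁆⁆ = 0 := by
  refine (Submodule.mem_bot ℂ).mp (coeff_mem_of_infinite ⊥ (Set.infinite_univ (α := ℂ)) 5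
    (outerSqCoeff r s v) (fun t _ => ?_) (i := 1) (by norm_num))
  rw [← outer_sq_add_smul, hv, Submodule.mem_bot]

/-- The vectors annihilated by all `(r r̄ᵗ)²` form a submodule. -/
def outerSqKer (n : ℕ) (V : Type*) [AddCommGroup V] [Module ℂ V]
    [LieRingModule (sp n) V] [LieModule ℂ (sp n) V] : LieSubmodule ℂ (sp n) V where
  carrier := {v | ∀ r : Idx n → ℂ, ⁅outer r, ⁅outer r, v⁆⁆ = 0}
  add_mem' hv hw r := by simp [hv r, hw r]
  zero_mem' r := by simp
  smul_mem' c v hv r := by simp [hv r]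
  lie_mem {x v} hv r := by
    -- Moving `x` through (outer r)² creates exactly the polarized expression with s = x r, which
    -- vanishes.
    have h := lie_outer_outer₂_add hv r (x.1.mulVec r)
    have h0 : ⁅x, ⁅outer r, ⁅outer r, v⁆⁆⁆ = 0 := by rw [hv r, lie_zero]
    rw [leibniz_lie, leibniz_lie x (outer r) v, lie_add, lie_outer_right, outer₂_comm] at h0
    linear_combination (norm := module) h0 - h

lemma mem_outerSqKer {v : V} :
    v ∈ outerSqKer n V ↔ ∀ r : Idx n → ℂ, ⁅outer r, ⁅outer r, v⁆⁆ = 0 := Iff.rfl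

/-- Being annihilated by all `(r r̄ᵗ)²` can be tested on the lattice. -/
lemma mem_outerSqKer_of_toC {v : V} (hv : ∀ r : Lat n, ⁅outer (toC r), ⁅outer (toC r), v⁆⁆ = 0) :
    v ∈ outerSqKer n V :=
  (isCoordPolynomial_outer_sq v).eq_zero hv

variable (n V) in
/-- All `(r r̄ᵗ)²` act by zero. -/
def OuterSqZero : Prop := ∀ (r : Idx n → ℂ) (v : V), ⁅outer r, ⁅outer r, v⁆⁆ = 0

lemma OuterSqZero.of_mem_ne_zero (hV : LieModule.IsIrreducible ℂ (sp n) V) {v : V}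
    (hv : v ∈ outerSqKer n V) (h0 : v ≠ 0) : OuterSqZero n V := fun r w => by
  have h := (hV.eq_bot_or_eq_top (outerSqKer n V)).resolve_left fun h => by
    rw [h, LieSubmodule.mem_bot] at hv
    exact h0 hv
  have hw : w ∈ outerSqKer n V := by rw [h]; exact LieSubmodule.mem_top w
  exact hw r

/-- The polarized relation says that `outer₂ a r` and `outer r` anticommute on V, while their
commutator is 2(ā, r) `outer r`; adding the two gives the claim. -/
lemma OuterSqZero.lie_outer₂_lie_outer (h : OuterSqZero n V) (a r : Idx n → ℂ) (v : V) :
    ⁅outer₂ a r, ⁅outer r, v⁆⁆ = (bar a ⬝ᵥ r) • ⁅outer r, v⁆ := by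
  have h1 := lie_outer_outer₂_add (fun r => h r v) r a
  have h2 : ⁅outer₂ a r, outer r⁆ = (2 * (bar a ⬝ᵥ r)) • outer r := by
    rw [lie_outer_right, outer₂_mulVec, bar_dotProduct_self, zero_smul, zero_add, map_smul,
      LinearMap.smul_apply, outer₂_self, smul_smul, mul_comm]
  have h3 := congrArg (fun x => ⁅x, v⁆) h2
  simp only [lie_lie, smul_lie] at h3
  rw [outer₂_comm r a] at h1
  have h4 : (2 : ℂ) • ⁅outer₂ a r, ⁅outer r, v⁆⁆ = (2 : ℂ) • ((bar a ⬝ᵥ r) • ⁅outer r, v⁆) := by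
    linear_combination (norm := module) h1 + h3
  exact smul_right_injective _ (two_ne_zero : (2 : ℂ) ≠ 0) h4

lemma lie_outer_outer (r s : Idx n → ℂ) :
    ⁅outer r, outer s⁆ = (bar r ⬝ᵥ s) • outer₂ r s := by
  rw [lie_outer_right, outer_mulVec, map_smul, LinearMap.smul_apply]

/-- The kernels of the `outer a` are compatible with the action of the Hamiltonian algebra. -/
lemma OuterSqZero.lie_outer_add_eq_zero (h : OuterSqZero n V) (a r : Idx n → ℂ) {v : V}
    (hv : ⁅outer a, v⁆ = 0) :
    ⁅outer (r + a), (bar r ⬝ᵥ a) • v + ⁅outer r, v⁆⁆ = 0 := by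
  have h1 := h.lie_outer₂_lie_outer a r v
  have h2 := congrArg (fun x => ⁅x, v⁆) (lie_outer_outer a r)
  simp only [lie_lie, smul_lie, hv, lie_zero, sub_zero] at h2
  -- Put c = (r̄, a) = -(ā, r). After expansion, c `outer r` v cancels against the product of
  -- `outer₂` and `outer r`, and c `outer₂ a r` v against the commutator of `outer a` and `outer r`.
  have h3 := bar_dotProduct_comm r a
  rw [outer_add, outer₂_comm r a]
  simp only [add_lie, lie_add, lie_smul, h r v, hv, h1, h2, h3]
  module

/-- `(r r̄ᵗ)² v = 0` propagates from `r` to `exp(x) r` if `x` annihilates `v`. -/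
lemma outer_sq_eq_zero_of_exp {x : sp n} {v : V} {r : Idx n → ℂ} (hx : ⁅x, v⁆ = 0)
    (hxr : x.1.mulVec (x.1.mulVec r) = 0) (hr : ⁅outer r, ⁅outer r, v⁆⁆ = 0) :
    ⁅outer (r + x.1.mulVec r), ⁅outer (r + x.1.mulVec r), v⁆⁆ = 0 := by
  set u := x.1.mulVec r with hu
  have hA : ⁅x, outer r⁆ = outer₂ r u := by rw [lie_outer_right, outer₂_comm]
  have hB : ⁅x, outer₂ r u⁆ = (2 : ℂ) • outer u := by
    rw [lie_outer₂, hxr, map_zero, add_zero, ← hu, outer₂_self]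
  have hC : ⁅x, outer u⁆ = 0 := by rw [lie_outer_right, hxr, map_zero, LinearMap.zero_apply]
  have step : ∀ y z : sp n, ⁅x, ⁅y, ⁅z, v⁆⁆⁆ = ⁅⁅x, y⁆, ⁅z, v⁆⁆ + ⁅y, ⁅⁅x, z⁆, v⁆⁆ := by
    intro y z
    rw [leibniz_lie, leibniz_lie x z, hx, lie_zero, add_zero]
  -- Since `x` kills `v`, applying `x` to the relation differentiates the two factors; `h1` to `h4`
  -- are its first four derivatives.
  have h1 := congrArg (fun w => ⁅x, w⁆) hr
  simp only [step, hA, lie_zero] at h1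
  have h2 := congrArg (fun w => ⁅x, w⁆) h1
  simp only [lie_add, step, hA, hB, lie_zero, smul_lie, lie_smul] at h2
  have h3 := congrArg (fun w => ⁅x, w⁆) h2
  simp only [lie_add, step, hA, hB, hC, lie_zero, smul_lie, lie_smul, zero_lie] at h3
  have h4 := congrArg (fun w => ⁅x, w⁆) h3
  simp only [lie_add, step, hB, hC, lie_zero, smul_lie, lie_smul, zero_lie] at h4
  rw [outer_add]
  simp only [add_lie, lie_add]
  -- The weights 1/j! are those of exp(x), and exp(x) r = r + x r because x² r = 0.
  linear_combination (norm := module) hr + h1 + (2⁻¹ : ℂ) • h2 + (6⁻¹ : ℂ) • h3 + (24⁻¹ : ℂ) • h4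

end OuterSquare

/-! ### Highest weight vectors of weight δ_k and the squares of long root vectors -/

section HighestWeightVector

variable {n : ℕ} {V : Type*} [AddCommGroup V] [Module ℂ V]
  [LieRingModule (sp n) V] [LieModule ℂ (sp n) V]

/-- The sign on the raising element comes from ē_i = -e_{n+i}: the matrix unit e_{i,n+i} is minus
e_i ē_iᵗ. -/
lemma isSl2Triple_cartan (i : Fin n) :
    IsSl2Triple (cartan i) (-outer (unit (Sum.inl i))) (outer (unit (Sum.inr i))) where
  h_ne_zero h := by
    have := congrFun (congrFun (congrArg Subtype.val h) (Sum.inl i)) (Sum.inl i)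
    simp [cartan] at this
  lie_e_f := by
    rw [neg_lie, lie_outer_outer, cartan_eq_outer₂]
    simp [unit_apply]
  lie_h_e_nsmul := by
    rw [lie_neg, lie_outer_right, cartan_eq_outer₂, outer₂_mulVec, ← Nat.cast_smul_eq_nsmul ℂ]
    simp [unit_apply, outer₂_self]
  lie_h_f_nsmul := by
    rw [lie_outer_right, cartan_eq_outer₂, outer₂_mulVec, ← Nat.cast_smul_eq_nsmul ℂ]
    simp [unit_apply, outer₂_self]

lemma IsHighestWeightVector.lie_outer_unit {w : Fin n → ℂ} {v : V}
    (hv : IsHighestWeightVector V w v) (i : Fin n) : ⁅outer (unit (Sum.inl i)), v⁆ = 0 := by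
  have h := hv.rootAdd_lie i i le_rfl
  rw [rootAdd_eq_outer₂, outer₂_self, neg_lie, smul_lie, neg_eq_zero] at h
  exact (smul_eq_zero.mp h).resolve_left two_ne_zero

/-- In a finite-dimensional module, all `(r r̄ᵗ)²` annihilate a highest weight vector of weight
`δ_k`. -/
lemma IsHighestWeightVector.mem_outerSqKer [FiniteDimensional ℂ V] (hn : 0 < n) {k : ℕ} {v : V}
    (hv : IsHighestWeightVector V (fundamentalWeight n k) v) : v ∈ outerSqKer n V := by
  set z : Fin n := ⟨0, hn⟩
  set f := unit (Sum.inr z : Idx n) with hf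
  -- The first entry of δ_k is 0 or 1, so by finite-dimensional 𝔰𝔩₂ theory the lowering element
  -- squares to zero on `v`.
  have hf2 : ⁅outer f, ⁅outer f, v⁆⁆ = 0 := by
    have P : (isSl2Triple_cartan z).HasPrimitiveVectorWith v (fundamentalWeight n k z) :=
      { ne_zero := hv.ne_zero
        lie_h := hv.cartan_lie z
        lie_e := by rw [neg_lie, hv.lie_outer_unit, neg_zero] }
    obtain ⟨m, hm, hm1⟩ : ∃ m : ℕ, fundamentalWeight n k z = m ∧ m ≤ 1 := by
      unfold fundamentalWeight
      split_ifs
      · exact ⟨1, by simp⟩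
      · exact ⟨0, by simp⟩
    have h := P.pow_toEnd_f_eq_zero_of_eq_nat hm
    interval_cases m
    · have h' : ⁅outer f, v⁆ = 0 := by simpa using h
      rw [h', lie_zero]
    · simpa [pow_two] using h
  -- Only positive roots ε_1 ± ε_j occur here: the excluded coordinate is the one that would bring
  -- in h_1.
  have hroot : ∀ (w : Idx n → ℂ), w (Sum.inr z) = 0 →
      ⁅outer₂ (unit (Sum.inl z)) w, v⁆ = 0 := by
    intro w hw
    have hsum := congrArg (outer₂ (unit (Sum.inl z))) (sum_smul_unit w)
    rw [hsum, map_sum, _root_.sum_lie]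
    refine Finset.sum_eq_zero fun i _ => ?_
    rw [map_smul, smul_lie]
    rcases i with j | j
    · have h := hv.rootAdd_lie z j (Nat.zero_le _)
      rw [rootAdd_eq_outer₂, neg_lie, neg_eq_zero] at h
      rw [h, smul_zero]
    · by_cases hj : j = z
      · rw [hj, hw, zero_smul]
      · have hlt : z < j := lt_of_le_of_ne (Nat.zero_le _) (Ne.symm hj)
        rw [← rootSub_eq_outer₂, hv.rootSub_lie z j hlt, smul_zero]
  -- Two exponentials of elements killing `v` carry c f to r: the first adds the component `w` away
  -- from the first symplectic plane, the second adds the multiple of e_1.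
  have hopen : ∀ r : Idx n → ℂ, r (Sum.inr z) ≠ 0 → ⁅outer r, ⁅outer r, v⁆⁆ = 0 := by
    intro r hr
    set c := r (Sum.inr z)
    set w : Idx n → ℂ := r - r (Sum.inl z) • unit (Sum.inl z) - c • f with hw
    have hw1 : w (Sum.inl z) = 0 := by simp [hw, unit_apply, hf]
    have hw2 : w (Sum.inr z) = 0 := by simp [hw, unit_apply, hf, c]
    have h1 : ⁅outer (c • f), ⁅outer (c • f), v⁆⁆ = 0 := by
      rw [outer_smul, smul_lie, smul_lie, lie_smul, hf2, smul_zero, smul_zero]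
    have hbw : bar w ⬝ᵥ f = 0 := by
      rw [bar_dotProduct_comm, hf, bar_unit_inr, unit_dotProduct, hw1, neg_zero]
    have e1 : (outer₂ (unit (Sum.inl z)) (-(c⁻¹) • w)).1.mulVec (c • f) = w := by
      rw [outer₂_mulVec, bar_smul, smul_dotProduct, dotProduct_smul, hbw, bar_unit_inl, hf]
      simp [unit_apply, hr, smul_smul]
    have e2 : (outer₂ (unit (Sum.inl z)) (-(c⁻¹) • w)).1.mulVec w = 0 := by
      rw [outer₂_mulVec, bar_smul, smul_dotProduct, bar_dotProduct_self, bar_unit_inl,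
        neg_dotProduct, unit_dotProduct, hw2]
      simp
    have h2 := outer_sq_eq_zero_of_exp (hroot (-(c⁻¹) • w) (by simp [hw2])) (by rw [e1, e2]) h1
    rw [e1] at h2
    have e3 : ((-(r (Sum.inl z) * c⁻¹)) • outer (unit (Sum.inl z))).1.mulVec (c • f + w) =
        r (Sum.inl z) • unit (Sum.inl z) := by
      rw [sp_coe_smul, Matrix.smul_mulVec, outer_mulVec, bar_unit_inl, neg_dotProduct,
        unit_dotProduct, Pi.add_apply, hw2, Pi.smul_apply, hf, smul_smul]
      simp [unit_apply, hr]
    have h3 := outer_sq_eq_zero_of_exp (x := (-(r (Sum.inl z) * c⁻¹)) • outer (unit (Sum.inl z)))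
      (by rw [smul_lie, hv.lie_outer_unit, smul_zero]) (by
        rw [e3, sp_coe_smul, Matrix.smul_mulVec, outer_mulVec, bar_unit_inl]
        simp [unit_apply]) h2
    rw [e3] at h3
    have e4 : c • f + w + r (Sum.inl z) • unit (Sum.inl z) = r := by rw [hw]; abel
    rwa [e4] at h3
  intro r
  -- The line r + t f leaves the open set for one t only, so the quartic in t vanishes; its constant
  -- term is the value at r.
  have hS : ({t : ℂ | (r + t • f) (Sum.inr z) ≠ 0}).Infinite := by
    refine Set.Infinite.mono (s := {-r (Sum.inr z)}ᶜ) (fun t ht => ?_)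
      (Set.finite_singleton _).infinite_compl
    simp only [hf, unit_apply, Pi.add_apply, Pi.smul_apply, if_true, smul_eq_mul, mul_one]
    intro h
    exact ht (by rw [Set.mem_singleton_iff]; linear_combination h)
  refine (Submodule.mem_bot ℂ).mp (coeff_mem_of_infinite ⊥ hS 5
    (outerSqCoeff r f v) (fun t ht => ?_) (i := 0) (by norm_num))
  rw [← outer_sq_add_smul, hopen _ ht, Submodule.mem_bot]

lemma IsFundamental.outerSqZero [FiniteDimensional ℂ V] (hn : 0 < n) {k : ℕ}
    (h : IsFundamental n V k) : OuterSqZero n V := by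
  obtain ⟨hV, v, hv⟩ := h
  exact OuterSqZero.of_mem_ne_zero hV (hv.mem_outerSqKer hn) hv.ne_zero

end HighestWeightVector

/-! ### Finite dimensionality -/

section FiniteDimension

variable {K L V ι : Type*} [Field K] [LieRing L] [AddCommGroup V] [Module K V]
  [LieRingModule L V]

/-- The iterated action of a list of elements. -/
def actList (x : ι → L) (v : V) (l : List ι) : V := l.foldr (fun i w => ⁅x i, w⁆) v

/-- The span of the vectors obtained from `v` by at most `d` actions. -/
def actSpan (K : Type*) [Field K] [Module K V] (x : ι → L) (v : V) (d : ℕ) : Submodule K V :=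
  Submodule.span K (actList x v '' {l | l.length ≤ d})

lemma actList_mem {x : ι → L} {v : V} {d : ℕ} {l : List ι} (h : l.length ≤ d) :
    actList x v l ∈ actSpan K x v d := Submodule.subset_span ⟨l, h, rfl⟩

variable [LieAlgebra K L] [LieModule K L V]

lemma lie_mem_actSpan {x : ι → L} (hx : Submodule.span K (Set.range x) = ⊤) {v w : V} {d : ℕ}
    (y : L) (hw : w ∈ actSpan K x v d) : ⁅y, w⁆ ∈ actSpan K x v (d + 1) := by
  have hy : y ∈ Submodule.span K (Set.range x) := hx ▸ Submodule.mem_top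
  induction hy, hw using Submodule.span_induction₂ with
  | mem_mem y w hy hw =>
    obtain ⟨i, rfl⟩ := hy
    obtain ⟨l, hl, rfl⟩ := hw
    exact actList_mem (l := i :: l) (Nat.succ_le_succ hl)
  | zero_left w _ => rw [zero_lie]; exact Submodule.zero_mem _
  | zero_right y _ => rw [lie_zero]; exact Submodule.zero_mem _
  | add_left y z w _ _ _ h1 h2 => rw [add_lie]; exact Submodule.add_mem _ h1 h2
  | add_right y w w' _ _ _ h1 h2 => rw [lie_add]; exact Submodule.add_mem _ h1 h2
  | smul_left c y w _ _ h => rw [smul_lie]; exact Submodule.smul_mem _ _ h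
  | smul_right c y w _ _ h => rw [lie_smul]; exact Submodule.smul_mem _ _ h

/-- Permuting a product changes it by products with fewer factors. -/
lemma actList_sub_mem_of_perm {x : ι → L} (hx : Submodule.span K (Set.range x) = ⊤) (v : V)
    {l l' : List ι} (h : l.Perm l') {d : ℕ} (hl : l.length ≤ d + 1) :
    actList x v l - actList x v l' ∈ actSpan K x v d := by
  induction h generalizing d with
  | nil => rw [sub_self]; exact Submodule.zero_mem _
  | @cons i l l' h ih =>
    change ⁅x i, actList x v l⁆ - ⁅x i, actList x v l'⁆ ∈ _
    rw [← lie_sub]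
    cases d with
    | zero =>
      obtain rfl : l = [] := List.length_eq_zero_iff.mp (by simpa using hl)
      rw [List.nil_perm.mp h, sub_self, lie_zero]
      exact Submodule.zero_mem _
    | succ d => exact lie_mem_actSpan hx _ (ih (by simpa using hl))
  | swap i j l =>
    change ⁅x j, ⁅x i, actList x v l⁆⁆ - ⁅x i, ⁅x j, actList x v l⁆⁆ ∈ _
    rw [← lie_lie]
    cases d with
    | zero => simp at hl
    | succ d => exact lie_mem_actSpan hx _ (actList_mem (by simpa using hl))
  | trans h1 h2 ih1 ih2 =>
    have := Submodule.add_mem _ (ih1 hl) (ih2 (h1.length_eq ▸ hl))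
    rwa [sub_add_sub_cancel] at this

/-- Pigeonhole: a word longer than the alphabet repeats a letter. Bringing both copies to the front
costs only shorter words, and the reordered word acts by zero. -/
lemma actList_mem_card [Fintype ι] {x : ι → L} (hx : Submodule.span K (Set.range x) = ⊤)
    (hsq : ∀ (i : ι) (v : V), ⁅x i, ⁅x i, v⁆⁆ = 0) (v : V) (l : List ι) :
    actList x v l ∈ actSpan K x v (Fintype.card ι) := by
  suffices H : ∀ (d : ℕ) (l : List ι), l.length ≤ d →
      actList x v l ∈ actSpan K x v (Fintype.card ι) from H _ l le_rfl
  intro d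
  induction d with
  | zero => exact fun l hl => actList_mem (hl.trans (Nat.zero_le _))
  | succ d ih =>
    intro l hl
    by_cases hnd : l.Nodup
    · exact actList_mem hnd.length_le_card
    · obtain ⟨i, hi⟩ := List.exists_duplicate_iff_not_nodup.mpr hnd
      obtain ⟨l', hl'⟩ := (List.duplicate_iff_sublist.mp hi).exists_perm_append
      have h := actList_sub_mem_of_perm hx v hl' hl
      have h0 : actList x v ([i, i] ++ l') = 0 := hsq i _
      rw [h0, sub_zero] at h
      refine (Submodule.span_le.mpr ?_ : actSpan K x v d ≤ _) h
      rintro _ ⟨l'', hl'', rfl⟩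
      exact ih l'' hl''

/-- An irreducible module is finite dimensional if the Lie algebra is spanned by finitely many
elements that square to zero on it. -/
lemma finiteDimensional_of_lie_lie_eq_zero [Finite ι] (hV : LieModule.IsIrreducible K L V)
    {x : ι → L} (hx : Submodule.span K (Set.range x) = ⊤)
    (hsq : ∀ (i : ι) (v : V), ⁅x i, ⁅x i, v⁆⁆ = 0) : FiniteDimensional K V := by
  have := Fintype.ofFinite ι
  have := LieModule.nontrivial_of_isIrreducible K L V
  obtain ⟨v, hv⟩ := exists_ne (0 : V)
  let N : LieSubmodule K L V :=
    { actSpan K x v (Fintype.card ι) with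
      lie_mem := fun {y w} hw => by
        refine (Submodule.span_le.mpr ?_ : actSpan K x v (Fintype.card ι + 1) ≤ _)
          (lie_mem_actSpan hx y hw)
        rintro _ ⟨l, -, rfl⟩
        exact actList_mem_card hx hsq v l }
  have hvN : v ∈ N := actList_mem (l := []) (Nat.zero_le _)
  have hN : N = ⊤ := (hV.eq_bot_or_eq_top N).resolve_left fun h => by
    rw [h, LieSubmodule.mem_bot] at hvN
    exact hv hvN
  have htop : actSpan K x v (Fintype.card ι) = ⊤ := by
    have := congrArg LieSubmodule.toSubmodule hN
    rwa [LieSubmodule.top_toSubmodule] at this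
  exact ⟨htop ▸ Submodule.fg_span ((List.finite_length_le ι _).image _)⟩

end FiniteDimension

/-! ### Existence of highest weight vectors -/

section ExistsHighestWeight

variable {n : ℕ} {V : Type*} [AddCommGroup V] [Module ℂ V]
  [LieRingModule (sp n) V] [LieModule ℂ (sp n) V]

lemma OuterSqZero.finiteDimensional (h : OuterSqZero n V)
    (hV : LieModule.IsIrreducible ℂ (sp n) V) : FiniteDimensional ℂ V :=
  finiteDimensional_of_lie_lie_eq_zero hV span_outer_unit_add fun _ v => h _ v

/-- `v` has the integral weight `w`. -/
def HasWeight (w : Fin n → ℤ) (v : V) : Prop := ∀ i, ⁅cartan i, v⁆ = (w i : ℂ) • v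

/-- The weight of a unit vector of `ℂ^N`. -/
def unitWeight : Idx n → Fin n → ℤ :=
  Sum.elim (fun j => Pi.single j 1) (fun j => -Pi.single j 1)

lemma cartan_mulVec_unit (i : Fin n) (a : Idx n) :
    (cartan i).1.mulVec (unit a) = (unitWeight a i : ℂ) • unit a := by
  rw [cartan_eq_outer₂, outer₂_mulVec, bar_unit_inl, bar_unit_inr, neg_dotProduct,
    unit_dotProduct, unit_dotProduct]
  rcases a with j | j <;> by_cases hj : i = j <;> simp [unit_apply, unitWeight, hj]

lemma HasWeight.lie_outer₂ {w : Fin n → ℤ} {v : V} (h : HasWeight w v) (a b : Idx n) :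
    HasWeight (w + unitWeight a + unitWeight b) ⁅outer₂ (unit a) (unit b), v⁆ := fun i => by
  rw [leibniz_lie, Hamiltonian.lie_outer₂, cartan_mulVec_unit, cartan_mulVec_unit, h i]
  simp only [map_smul, LinearMap.smul_apply, add_lie, smul_lie, lie_smul, Pi.add_apply,
    Int.cast_add]
  module

lemma lie_outer_unit_inr_inl (i : Fin n) :
    ⁅outer (unit (Sum.inr i)), outer (unit (Sum.inl i))⁆ = cartan i := by
  rw [lie_outer_outer, outer₂_comm, cartan_eq_outer₂, bar_unit_inr, unit_dotProduct]
  simp [unit_apply]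

/-- Write h_i = XY - YX with long root elements X, Y. On V, `lie_outer₂_lie_outer` gives h_i X = -X
and h_i Y = Y, so multiplying by h_i twice returns XY - YX. -/
lemma OuterSqZero.cartan_cube (h : OuterSqZero n V) (i : Fin n) (v : V) :
    ⁅cartan i, ⁅cartan i, ⁅cartan i, v⁆⁆⁆ = ⁅cartan i, v⁆ := by
  have hY : ∀ w : V, ⁅cartan i, ⁅outer (unit (Sum.inl i)), w⁆⁆ =
      ⁅outer (unit (Sum.inl i)), w⁆ := fun w => by
    rw [cartan_eq_outer₂, outer₂_comm, h.lie_outer₂_lie_outer, bar_unit_inr, unit_dotProduct]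
    simp [unit_apply]
  have hX : ∀ w : V, ⁅cartan i, ⁅outer (unit (Sum.inr i)), w⁆⁆ =
      -⁅outer (unit (Sum.inr i)), w⁆ := fun w => by
    rw [cartan_eq_outer₂, h.lie_outer₂_lie_outer, bar_unit_inl, neg_dotProduct, unit_dotProduct]
    simp [unit_apply]
  have e : ⁅cartan i, v⁆ = ⁅outer (unit (Sum.inr i)), ⁅outer (unit (Sum.inl i)), v⁆⁆ -
      ⁅outer (unit (Sum.inl i)), ⁅outer (unit (Sum.inr i)), v⁆⁆ := by
    rw [← lie_lie, lie_outer_unit_inr_inl]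
  rw [e]
  simp only [lie_sub, hX, hY, lie_neg, neg_neg]

lemma OuterSqZero.weight_mem (h : OuterSqZero n V) {w : Fin n → ℤ} {v : V} (hv : v ≠ 0)
    (hw : HasWeight w v) (i : Fin n) : w i = -1 ∨ w i = 0 ∨ w i = 1 := by
  have h1 := h.cartan_cube i v
  simp only [hw i, lie_smul, smul_smul] at h1
  have h2 := smul_left_injective ℂ hv h1
  have h3 : w i * w i * w i = w i := by exact_mod_cast h2
  have h4 : w i * ((w i - 1) * (w i + 1)) = 0 := by linear_combination h3
  rcases mul_eq_zero.mp h4 with h | h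
  · exact Or.inr (Or.inl h)
  · rcases mul_eq_zero.mp h with h | h <;> omega

lemma lie_cartan_cartan (i j : Fin n) : ⁅cartan i, cartan j⁆ = 0 := by
  rw [cartan_eq_outer₂ j, lie_outer₂, cartan_mulVec_unit, cartan_mulVec_unit]
  simp only [map_smul, LinearMap.smul_apply, ← add_smul, unitWeight, Sum.elim_inl, Sum.elim_inr]
  simp

lemma OuterSqZero.exists_hasWeight [Nontrivial V] (h : OuterSqZero n V) :
    ∃ (w : Fin n → ℤ) (v : V), v ≠ 0 ∧ HasWeight w v := by
  suffices H : ∀ S : Finset (Fin n), ∃ (w : Fin n → ℤ) (v : V), v ≠ 0 ∧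
      ∀ i ∈ S, ⁅cartan i, v⁆ = (w i : ℂ) • v by
    obtain ⟨w, v, hv, hw⟩ := H Finset.univ
    exact ⟨w, v, hv, fun i => hw i (Finset.mem_univ i)⟩
  intro S
  induction S using Finset.induction_on with
  | empty =>
    obtain ⟨v, hv⟩ := exists_ne (0 : V)
    exact ⟨0, v, hv, by simp⟩
  | insert j S hj ih =>
    obtain ⟨w, v, hv, hw⟩ := ih
    suffices H : ∃ (c : ℤ) (v' : V), v' ≠ 0 ∧ ⁅cartan j, v'⁆ = (c : ℂ) • v' ∧
        ∀ i ∈ S, ⁅cartan i, v'⁆ = (w i : ℂ) • v' by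
      obtain ⟨c, v', h0, hc, hS⟩ := H
      refine ⟨Function.update w j c, v', h0, fun i hi => ?_⟩
      rcases Finset.mem_insert.mp hi with rfl | hi
      · simpa using hc
      · rw [Function.update_of_ne (fun e : i = j => hj (e ▸ hi))]
        exact hS i hi
    have hcomm : ∀ i ∈ S, ∀ u : V, ⁅cartan i, u⁆ = (w i : ℂ) • u →
        ⁅cartan i, ⁅cartan j, u⁆⁆ = (w i : ℂ) • ⁅cartan j, u⁆ := fun i _ u hu => by
      rw [leibniz_lie, lie_cartan_cartan, zero_lie, zero_add, hu, lie_smul]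
    have h1 : ∀ i ∈ S, ⁅cartan i, ⁅cartan j, v⁆⁆ = (w i : ℂ) • ⁅cartan j, v⁆ :=
      fun i hi => hcomm i hi v (hw i hi)
    have h2 : ∀ i ∈ S, ⁅cartan i, ⁅cartan j, ⁅cartan j, v⁆⁆⁆ =
        (w i : ℂ) • ⁅cartan j, ⁅cartan j, v⁆⁆ := fun i hi => hcomm i hi _ (h1 i hi)
    have h3 := h.cartan_cube j v
    -- Since h³ = h, the vectors (h² + h)v and (h² - h)v have eigenvalues 1 and -1; if both vanish,
    -- hv = 0. They keep the earlier eigenvalues because the h_i commute.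
    by_cases hp : ⁅cartan j, ⁅cartan j, v⁆⁆ + ⁅cartan j, v⁆ = 0
    · by_cases hm : ⁅cartan j, ⁅cartan j, v⁆⁆ - ⁅cartan j, v⁆ = 0
      · refine ⟨0, v, hv, ?_, hw⟩
        have : (2 : ℂ) • ⁅cartan j, v⁆ = 0 := by linear_combination (norm := module) hp - hm
        rw [Int.cast_zero, zero_smul]
        exact (smul_eq_zero.mp this).resolve_left two_ne_zero
      · refine ⟨-1, _, hm, ?_, fun i hi => ?_⟩
        · rw [lie_sub, h3]; push_cast; module
        · rw [lie_sub, h1 i hi, h2 i hi]; module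
    · refine ⟨1, _, hp, ?_, fun i hi => ?_⟩
      · rw [lie_add, h3]; push_cast; module
      · rw [lie_add, h1 i hi, h2 i hi]; module

/-- A linear functional on weights that is positive on the positive roots. -/
def height (w : Fin n → ℤ) : ℤ := ∑ i : Fin n, ((n : ℤ) - (i : ℕ)) * w i

lemma height_add (w w' : Fin n → ℤ) : height (w + w') = height w + height w' := by
  simp [height, mul_add, Finset.sum_add_distrib]

lemma height_unitWeight_inl (i : Fin n) : height (unitWeight (Sum.inl i)) = (n : ℤ) - (i : ℕ) := by
  simp [height, unitWeight, Pi.single_apply]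

lemma height_unitWeight_inr (i : Fin n) :
    height (unitWeight (Sum.inr i)) = -((n : ℤ) - (i : ℕ)) := by
  simp [height, unitWeight, Pi.single_apply]

/-- An irreducible module on which all `(r r̄ᵗ)²` vanish is one of the `V(δ_k)`. -/
lemma OuterSqZero.exists_isFundamental (h : OuterSqZero n V)
    (hV : LieModule.IsIrreducible ℂ (sp n) V) : ∃ k ≤ n, IsFundamental n V k := by
  have := LieModule.nontrivial_of_isIrreducible ℂ (sp n) V
  set Λ : Set (Fin n → ℤ) := {w | ∃ v : V, v ≠ 0 ∧ HasWeight w v}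
  have hfin : Λ.Finite := by
    refine (Set.Finite.pi' fun _ : Fin n => Set.finite_Icc (-1 : ℤ) 1).subset ?_
    rintro w ⟨v, hv, hw⟩ i
    rcases h.weight_mem hv hw i with h | h | h <;> simp [h]
  obtain ⟨w₀, v₀, hv₀, hw₀⟩ := h.exists_hasWeight
  obtain ⟨w, ⟨v, hv, hw⟩, hmax⟩ := hfin.exists_maximalFor height Λ ⟨w₀, v₀, hv₀, hw₀⟩
  have hpos : ∀ a b : Idx n, 0 < height (unitWeight a) + height (unitWeight b) →
      ⁅outer₂ (unit a) (unit b), v⁆ = 0 := fun a b hab => by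
    by_contra hne
    have h1 := hmax (j := w + unitWeight a + unitWeight b) ⟨_, hne, hw.lie_outer₂ a b⟩
    rw [height_add, height_add] at h1
    have := h1 (by linarith)
    linarith
  have hsmall : ∀ (a b : Idx n) (i : Fin n),
      ¬((w + unitWeight a + unitWeight b) i = -1 ∨ (w + unitWeight a + unitWeight b) i = 0 ∨
        (w + unitWeight a + unitWeight b) i = 1) → ⁅outer₂ (unit a) (unit b), v⁆ = 0 :=
    fun a b i hi => by
      by_contra hne
      exact hi (h.weight_mem hne (hw.lie_outer₂ a b) i)
  have hadd : ∀ k l : Fin n, ⁅outer₂ (unit (Sum.inl k)) (unit (Sum.inl l)), v⁆ = 0 :=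
    fun k l => hpos _ _ (by
      rw [height_unitWeight_inl, height_unitWeight_inl]
      have := k.2; have := l.2; omega)
  have hsub : ∀ i j : Fin n, i < j → ⁅outer₂ (unit (Sum.inl i)) (unit (Sum.inr j)), v⁆ = 0 :=
    fun i j hij => hpos _ _ (by
      rw [height_unitWeight_inl, height_unitWeight_inr]
      have : (i : ℕ) < j := hij
      omega)
  -- Lowering along 2ε_i would produce the entry -3, and raising vanishes by maximality, so their
  -- commutator h_i kills `v`.
  have hneg : ∀ i, w i ≠ -1 := fun i hi => by
    have e1 := hadd i i
    have e2 := hsmall (Sum.inr i) (Sum.inr i) i (by simp [unitWeight, hi])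
    rw [outer₂_self, smul_lie] at e1 e2
    have e1' := (smul_eq_zero.mp e1).resolve_left two_ne_zero
    have e2' := (smul_eq_zero.mp e2).resolve_left two_ne_zero
    have e3 := hw i
    rw [← lie_outer_unit_inr_inl, lie_lie, e1', e2', lie_zero, lie_zero, sub_zero, hi] at e3
    exact hv ((smul_eq_zero.mp e3.symm).resolve_left (by norm_num))
  -- The root vector of ε_j - ε_i would produce the entry 2 at j, and its opposite kills `v` by
  -- maximality; yet their commutator h_i - h_j acts by -1.
  have hanti : ∀ i j : Fin n, i < j → w i = 0 → w j ≠ 1 := fun i j hij hi hj => by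
    have e1 := hsub i j hij
    have e2 := hsmall (Sum.inl j) (Sum.inr i) j (by simp [unitWeight, hj, hij.ne'])
    have e3 : ⁅outer₂ (unit (Sum.inl i)) (unit (Sum.inr j)),
        outer₂ (unit (Sum.inl j)) (unit (Sum.inr i))⁆ = cartan i - cartan j := by
      rw [Hamiltonian.lie_outer₂, outer₂_mulVec, outer₂_mulVec, cartan_eq_outer₂, cartan_eq_outer₂]
      simp [unit_apply, sub_eq_add_neg]
    have e4 := congrArg (fun x => ⁅x, v⁆) e3
    simp only [lie_lie, e1, e2, lie_zero, sub_zero, sub_lie, hw i, hw j, hi, hj, Int.cast_zero,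
      zero_smul, Int.cast_one, one_smul, zero_sub] at e4
    exact hv (neg_eq_zero.mp e4.symm)
  have h01 : ∀ i, w i = 0 ∨ w i = 1 := fun i => (h.weight_mem hv hw i).resolve_left (hneg i)
  -- The entries are ones followed by zeros: k is the (0-based) position of the first zero, or n if
  -- there is none.
  obtain ⟨k, hk, hwk⟩ : ∃ k ≤ n, ∀ i : Fin n, w i = if (i : ℕ) < k then 1 else 0 := by
    by_cases hall : ∃ k, ∃ hk : k < n, w ⟨k, hk⟩ = 0
    · classical
      obtain ⟨hk, hk0⟩ := Nat.find_spec hall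
      refine ⟨Nat.find hall, hk.le, fun i => ?_⟩
      split_ifs with hi
      · exact (h01 i).resolve_left fun h0 => Nat.find_min hall hi ⟨i.2, h0⟩
      · rcases (not_lt.mp hi).eq_or_lt with hi | hi
        · rw [← hk0]; exact congrArg w (Fin.ext hi.symm)
        · exact (h01 i).resolve_right (hanti _ i hi hk0)
    · refine ⟨n, le_rfl, fun i => ?_⟩
      rw [if_pos i.2]
      exact (h01 i).resolve_left fun h0 => hall ⟨i, i.2, h0⟩
  refine ⟨k, hk, hV, v, hv, fun i j hij => ?_, fun k l _ => ?_, fun i => ?_⟩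
  · rw [rootSub_eq_outer₂, hsub i j hij]
  · rw [rootAdd_eq_outer₂, neg_lie, hadd, neg_zero]
  · rw [hw i, hwk i, fundamentalWeight]
    split_ifs <;> simp

end ExistsHighestWeight

/-! ### Graded structure of the modules `F^{α,β}(V)` -/

section Graded

variable {n : ℕ} {α β : Idx n → ℂ} {V : Type*} [AddCommGroup V] [Module ℂ V]

variable (α β V) in
/-- The linear map `v ↦ v ⊗ t^s`. -/
def F.tmulLin (s : Lat n) : V →ₗ[ℂ] F α β V where
  toFun v := F.tmul α β v s
  map_add' v w := TensorProduct.add_tmul v w _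
  map_smul' c v := (TensorProduct.smul_tmul' c v _).symm

lemma F.add_tmul (v w : V) (s : Lat n) :
    F.tmul α β (v + w) s = F.tmul α β v s + F.tmul α β w s := map_add (F.tmulLin α β V s) v w

lemma F.smul_tmul (c : ℂ) (v : V) (s : Lat n) :
    F.tmul α β (c • v) s = c • F.tmul α β v s := map_smul (F.tmulLin α β V s) c v

lemma F.zero_tmul (s : Lat n) : F.tmul α β (0 : V) s = 0 := map_zero (F.tmulLin α β V s)

variable (α β V) in
/-- The coefficient of `t^s`. -/
def F.coeff (s : Lat n) : F α β V →ₗ[ℂ] V :=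
  ((TensorProduct.rid ℂ V).toLinearMap ∘ₗ
    TensorProduct.map LinearMap.id ((monoBasis n).coord s) : V ⊗[ℂ] Laurent n →ₗ[ℂ] V)

lemma F.coeff_tmul (s r : Lat n) (v : V) :
    F.coeff α β V s (F.tmul α β v r) = if r = s then v else 0 := by
  change TensorProduct.rid ℂ V (TensorProduct.map LinearMap.id ((monoBasis n).coord s)
    (v ⊗ₜ mono r)) = _
  rw [TensorProduct.map_tmul, TensorProduct.rid_tmul, ← monoBasis_apply, Module.Basis.coord_apply,
    Module.Basis.repr_self, Finsupp.single_apply, LinearMap.id_apply]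
  split_ifs <;> simp

lemma F.exists_sum (m : F α β V) : ∃ (T : Finset (Lat n)) (f : Lat n → V),
    m = ∑ s ∈ T, F.tmul α β (f s) s := by
  set g := TensorProduct.equivFinsuppOfBasisRight (M := V) (monoBasis n) m with hg
  refine ⟨g.support, g, ?_⟩
  have h := (TensorProduct.equivFinsuppOfBasisRight (M := V) (monoBasis n)).symm_apply_apply m
  rw [← hg, TensorProduct.equivFinsuppOfBasisRight_symm_apply] at h
  simp only [monoBasis_apply] at h
  exact h.symm

lemma F.tmul_ne_zero {v : V} (hv : v ≠ 0) (s : Lat n) : F.tmul α β v s ≠ 0 := fun h => by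
  have := F.coeff_tmul (α := α) (β := β) s s v
  rw [h, map_zero, if_pos rfl] at this
  exact hv this.symm

lemma F.nontrivial [Nontrivial V] : Nontrivial (F α β V) := by
  obtain ⟨v, hv⟩ := exists_ne (0 : V)
  exact ⟨⟨_, 0, F.tmul_ne_zero (α := α) (β := β) hv 0⟩⟩

variable [LieRingModule (sp n) V] [LieModule ℂ (sp n) V]

lemma F.coeff_hamH_lie (r s : Lat n) (m : F α β V) :
    F.coeff α β V (r + s) ⁅hamH r, m⁆ =
      (bar (toC r) ⬝ᵥ (toC s + α)) • F.coeff α β V s m +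
        ⁅outer (toC r), F.coeff α β V s m⁆ := by
  obtain ⟨T, f, rfl⟩ := F.exists_sum m
  simp only [lie_sum, map_sum, Finset.smul_sum, ← Finset.sum_add_distrib]
  refine Finset.sum_congr rfl fun p _ => ?_
  rw [hamH_lie_tmul, F.coeff_tmul, F.coeff_tmul]
  by_cases h : p = s
  · subst h; simp
  · simp [h]

lemma F.coeff_degH_lie (i : Idx n) (s : Lat n) (m : F α β V) :
    F.coeff α β V s ⁅degH i, m⁆ = ((s i : ℂ) + β i) • F.coeff α β V s m := by
  obtain ⟨T, f, rfl⟩ := F.exists_sum m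
  simp only [lie_sum, map_sum, Finset.smul_sum]
  refine Finset.sum_congr rfl fun p _ => ?_
  rw [degH_lie_tmul, map_smul, F.coeff_tmul]
  by_cases h : p = s
  · subst h; simp
  · simp [h]

/-- A family of subspaces of `V` compatible with the action gives a graded submodule. -/
def gradedSubmodule (β : Idx n → ℂ) (K : Lat n → Submodule ℂ V)
    (hK : ∀ (r s : Lat n), ∀ v ∈ K s,
      (bar (toC r) ⬝ᵥ (toC s + α)) • v + ⁅outer (toC r), v⁆ ∈ K (r + s)) :
    LieSubmodule ℂ (H n) (F α β V) where
  carrier := {m | ∀ s, F.coeff α β V s m ∈ K s}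
  add_mem' ha hb s := by rw [map_add]; exact (K s).add_mem (ha s) (hb s)
  zero_mem' s := by rw [map_zero]; exact (K s).zero_mem
  smul_mem' c m hm s := by rw [map_smul]; exact (K s).smul_mem c (hm s)
  lie_mem {x m} hm s := by
    induction (basisH n).mem_span x using Submodule.span_induction with
    | mem x hx =>
      obtain ⟨r | i, rfl⟩ := hx
      · rw [basisH_inl]
        have := hK r.1 (s - r.1) _ (hm (s - r.1))
        rwa [← F.coeff_hamH_lie, add_sub_cancel] at this
      · rw [basisH_inr, F.coeff_degH_lie]
        exact (K s).smul_mem _ (hm s)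
    | zero => rw [zero_lie, map_zero]; exact (K s).zero_mem
    | add x y _ _ hx hy => rw [add_lie, map_add]; exact (K s).add_mem hx hy
    | smul c x _ hx => rw [smul_lie, map_smul]; exact (K s).smul_mem c hx

lemma tmul_mem_gradedSubmodule {K : Lat n → Submodule ℂ V}
    {hK : ∀ (r s : Lat n), ∀ v ∈ K s,
      (bar (toC r) ⬝ᵥ (toC s + α)) • v + ⁅outer (toC r), v⁆ ∈ K (r + s)} {v : V} {s : Lat n} :
    F.tmul α β v s ∈ gradedSubmodule β K hK ↔ v ∈ K s := by
  refine ⟨fun h => ?_, fun h p => ?_⟩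
  · have := h s
    rwa [F.coeff_tmul, if_pos rfl] at this
  · rw [F.coeff_tmul]
    split_ifs with hp
    · exact hp ▸ h
    · exact (K p).zero_mem

lemma not_isIrreducible_of_family (β : Idx n → ℂ) (K : Lat n → Submodule ℂ V)
    (hK : ∀ (r s : Lat n), ∀ v ∈ K s,
      (bar (toC r) ⬝ᵥ (toC s + α)) • v + ⁅outer (toC r), v⁆ ∈ K (r + s))
    {s₀ s₁ : Lat n} (h₀ : K s₀ ≠ ⊥) (h₁ : K s₁ ≠ ⊤) :
    ¬LieModule.IsIrreducible ℂ (H n) (F α β V) := fun hirr => by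
  obtain ⟨v, hv, hv0⟩ := Submodule.exists_mem_ne_zero_of_ne_bot h₀
  rcases hirr.eq_bot_or_eq_top (gradedSubmodule β K hK) with h | h
  · have := tmul_mem_gradedSubmodule (β := β) (hK := hK).mpr hv
    rw [h, LieSubmodule.mem_bot] at this
    exact F.tmul_ne_zero hv0 _ this
  · refine h₁ (eq_top_iff.mpr fun w _ => ?_)
    refine (tmul_mem_gradedSubmodule (β := β) (hK := hK)).mp ?_
    rw [h]
    exact LieSubmodule.mem_top _

/-- A submodule of `F^{α,β}(V)` contains the homogeneous components of its elements. -/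
lemma tmul_mem_of_sum_mem (M : LieSubmodule ℂ (H n) (F α β V)) (T : Finset (Lat n))
    (f : Lat n → V) (h : ∑ s ∈ T, F.tmul α β (f s) s ∈ M) :
    ∀ s ∈ T, F.tmul α β (f s) s ∈ M := by
  induction T using Finset.induction_on generalizing f with
  | empty => simp
  | insert p T hp ih =>
    have hT : ∀ s ∈ T, F.tmul α β (f s) s ∈ M := by
      intro s hs
      obtain ⟨i, hi⟩ : ∃ i, s i ≠ p i := Function.ne_iff.mp fun e => hp (e ▸ hs)
      -- d_i minus its eigenvalue in degree p removes that component and scales the one in degree s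
      -- by s_i - p_i ≠ 0.
      have h1 := M.sub_mem (M.lie_mem (x := degH i) h) (M.smul_mem ((p i : ℂ) + β i) h)
      have h2 : ⁅degH i, ∑ s ∈ insert p T, F.tmul α β (f s) s⁆ -
          ((p i : ℂ) + β i) • ∑ s ∈ insert p T, F.tmul α β (f s) s =
          ∑ s ∈ T, F.tmul α β (((s i : ℂ) - p i) • f s) s := by
        rw [lie_sum, Finset.smul_sum, ← Finset.sum_sub_distrib, Finset.sum_insert hp]
        simp only [degH_lie_tmul, sub_self, zero_add, F.smul_tmul]
        exact Finset.sum_congr rfl fun q _ => by module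
      rw [h2] at h1
      have h3 := M.smul_mem ((s i : ℂ) - p i)⁻¹ (ih _ h1 s hs)
      have hne : (s i : ℂ) - p i ≠ 0 := sub_ne_zero.mpr (by exact_mod_cast hi)
      rwa [F.smul_tmul, smul_smul, inv_mul_cancel₀ hne, one_smul] at h3
    intro s hs
    rcases Finset.mem_insert.mp hs with rfl | hs
    · rw [Finset.sum_insert hp] at h
      have := M.sub_mem h (M.sum_mem hT)
      rwa [add_sub_cancel_right] at this
    · exact hT s hs

/-- The subspace of the `v` with `v ⊗ t^s ∈ M`. -/
def fiber (M : LieSubmodule ℂ (H n) (F α β V)) (s : Lat n) : Submodule ℂ V :=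
  M.toSubmodule.comap (F.tmulLin α β V s)

lemma mem_fiber {M : LieSubmodule ℂ (H n) (F α β V)} {s : Lat n} {v : V} :
    v ∈ fiber M s ↔ F.tmul α β v s ∈ M := Iff.rfl

lemma exists_fiber_ne_bot {M : LieSubmodule ℂ (H n) (F α β V)} (hM : M ≠ ⊥) :
    ∃ s, ∃ v ∈ fiber M s, v ≠ 0 := by
  obtain ⟨m, hm, hm0⟩ := Submodule.exists_mem_ne_zero_of_ne_bot
    (mt (LieSubmodule.toSubmodule_eq_bot M).mp hM)
  obtain ⟨T, f, rfl⟩ := F.exists_sum m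
  obtain ⟨s, hs, hne⟩ := Finset.exists_ne_zero_of_sum_ne_zero hm0
  exact ⟨s, f s, tmul_mem_of_sum_mem M T f hm s hs,
    fun h => hne (by rw [h, F.zero_tmul])⟩

lemma eq_top_of_fiber {M : LieSubmodule ℂ (H n) (F α β V)} (h : ∀ s, ∀ v : V, v ∈ fiber M s) :
    M = ⊤ := by
  refine eq_top_iff.mpr fun m _ => ?_
  obtain ⟨T, f, rfl⟩ := F.exists_sum m
  exact M.sum_mem fun s _ => h s (f s)

lemma hamH_mem_fiber {M : LieSubmodule ℂ (H n) (F α β V)} {s : Lat n} {v : V}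
    (hv : v ∈ fiber M s) (r : Lat n) :
    (bar (toC r) ⬝ᵥ (toC s + α)) • v + ⁅outer (toC r), v⁆ ∈ fiber M (r + s) := by
  have := M.lie_mem (x := hamH r) (mem_fiber.mp hv)
  rwa [hamH_lie_tmul] at this

/-- The coefficients of `H_{m-kq} H_{kq} (v ⊗ t^s)` as a polynomial in `k`, with `a = s + α`. -/
def doubleCoeff (a m q : Idx n → ℂ) (v : V) : ℕ → V
  | 0 => 0
  | 1 => ((bar m ⬝ᵥ a) * (bar q ⬝ᵥ a)) • v + (bar q ⬝ᵥ a) • ⁅outer m, v⁆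
  | 2 => (bar m ⬝ᵥ a) • ⁅outer q, v⁆ + ((bar m ⬝ᵥ q - bar q ⬝ᵥ a) * (bar q ⬝ᵥ a)) • v +
      ⁅outer m, ⁅outer q, v⁆⁆ - (bar q ⬝ᵥ a) • ⁅outer₂ m q, v⁆
  | 3 => (bar m ⬝ᵥ q) • ⁅outer q, v⁆ - ⁅outer₂ m q, ⁅outer q, v⁆⁆
  | _ => ⁅outer q, ⁅outer q, v⁆⁆

/-- H_{m-kq} H_{kq} shifts degrees by m for every integer k, so all values of the polynomial lie in
a single fiber, and hence so do its coefficients. -/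
lemma doubleCoeff_mem_fiber {M : LieSubmodule ℂ (H n) (F α β V)} {s : Lat n} {v : V}
    (hv : v ∈ fiber M s) (m q : Lat n) {i : ℕ} (hi : i < 5) :
    doubleCoeff (toC s + α) (toC m) (toC q) v i ∈ fiber M (m + s) := by
  refine coeff_mem_of_infinite _ infinite_range_intCast 5 _ ?_ hi
  rintro _ ⟨k, rfl⟩
  have h := hamH_mem_fiber (hamH_mem_fiber hv (k • q)) (m - k • q)
  rw [← add_assoc, sub_add_cancel] at h
  convert h using 1
  have e1 : toC (k • q) = (k : ℂ) • toC q := by ext; simp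
  have e2 : toC (m - k • q) = toC m - (k : ℂ) • toC q := by ext; simp
  have e3 : bar (toC m - (k : ℂ) • toC q) = bar (toC m) - (k : ℂ) • bar (toC q) := by
    rw [sub_eq_add_neg, bar_add, bar_neg, bar_smul, ← sub_eq_add_neg]
  have e4 := bar_dotProduct_self (toC q)
  rw [toC_add, e1, e2, e3, outer_sub, outer_smul, map_smul, bar_smul]
  simp only [add_assoc, dotProduct_add, sub_dotProduct, smul_dotProduct, dotProduct_smul, e4,
    lie_add, lie_smul, add_lie, sub_lie, smul_lie, Finset.sum_range_succ, Finset.sum_range_zero,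
    doubleCoeff, smul_eq_mul]
  module

end Graded

/-! ### Irreducibility -/

section Irreducibility

variable {n : ℕ} {α β : Idx n → ℂ} {V : Type*} [AddCommGroup V] [Module ℂ V]
  [LieRingModule (sp n) V] [LieModule ℂ (sp n) V]

lemma lie_mem_of_forall_outer_mem {p : Submodule ℂ V} {v : V}
    (h : ∀ r : Lat n, ⁅outer (toC r), v⁆ ∈ p) (x : sp n) : ⁅x, v⁆ ∈ p := by
  have hx : x ∈ Submodule.span ℂ (Set.range fun r : Lat n => outer (toC r)) := by
    rw [span_outer_toC]; exact Submodule.mem_top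
  induction hx using Submodule.span_induction with
  | mem x hx => obtain ⟨r, rfl⟩ := hx; exact h r
  | zero => rw [zero_lie]; exact p.zero_mem
  | add x y _ _ hx hy => rw [add_lie]; exact p.add_mem hx hy
  | smul c x _ hx => rw [smul_lie]; exact p.smul_mem c hx

/-- The vectors lying in all the fibers of a submodule form an `𝔰𝔭_N`-submodule. -/
def fiberInf (M : LieSubmodule ℂ (H n) (F α β V)) : LieSubmodule ℂ (sp n) V where
  __ := ⨅ s, fiber M s
  lie_mem {x v} hv := by
    change v ∈ ⨅ s, fiber M s at hv
    change ⁅x, v⁆ ∈ ⨅ s, fiber M s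
    rw [Submodule.mem_iInf] at hv ⊢
    refine fun s => lie_mem_of_forall_outer_mem (fun r => ?_) x
    -- Starting from degree s - r, H_r lands in degree s, where the scalar multiple of `v` can be
    -- subtracted.
    have h1 := hamH_mem_fiber (hv (s - r)) r
    rw [add_sub_cancel] at h1
    exact ((fiber M s).add_mem_iff_right ((fiber M s).smul_mem _ (hv s))).mp h1

lemma isIrreducible_of_not_outerSqZero (hV : LieModule.IsIrreducible ℂ (sp n) V)
    (h : ¬OuterSqZero n V) : LieModule.IsIrreducible ℂ (H n) (F α β V) := by
  have := LieModule.nontrivial_of_isIrreducible ℂ (sp n) V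
  have := F.nontrivial (α := α) (β := β) (V := V)
  refine LieModule.IsIrreducible.mk fun M hM => ?_
  obtain ⟨s, v, hv, hv0⟩ := exists_fiber_ne_bot hM
  obtain ⟨q, hq⟩ : ∃ q : Lat n, ⁅outer (toC q), ⁅outer (toC q), v⁆⁆ ≠ 0 := by
    by_contra! hall
    exact h (OuterSqZero.of_mem_ne_zero hV (mem_outerSqKer_of_toC hall) hv0)
  have hmem : ⁅outer (toC q), ⁅outer (toC q), v⁆⁆ ∈ fiberInf M := by
    refine (Submodule.mem_iInf _).mpr fun p => ?_
    have := doubleCoeff_mem_fiber hv (p - s) q (i := 4) (by norm_num)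
    rwa [sub_add_cancel] at this
  have htop : fiberInf M = ⊤ := (hV.eq_bot_or_eq_top _).resolve_left fun hb => by
    rw [hb, LieSubmodule.mem_bot] at hmem
    exact hq hmem
  refine eq_top_of_fiber fun s v => ?_
  have hvt : v ∈ fiberInf M := by rw [htop]; exact LieSubmodule.mem_top v
  exact (Submodule.mem_iInf _).mp hvt s

lemma IsCoordPolynomial.comp_add {ι W : Type*} [DecidableEq ι] [AddCommGroup W] [Module ℂ W]
    {d : ℕ} {f : (ι → ℂ) → W} (hf : IsCoordPolynomial d f) (a : ι → ℂ) :
    IsCoordPolynomial d fun r => f (r + a) := fun r i => by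
  obtain ⟨c, hc⟩ := hf (r + a) i
  exact ⟨c, fun t => by rw [← hc, add_right_comm]⟩

/-- r ↦ `outer r` v is polynomial, so vanishing on the coset ℤ^N + α forces it to vanish
identically; the `outer` elements span 𝔰𝔭_N. -/
lemma lie_eq_zero_of_forall_shift (α : Idx n → ℂ) {v : V}
    (h : ∀ s : Lat n, ⁅outer (toC s + α), v⁆ = 0) (x : sp n) : ⁅x, v⁆ = 0 := by
  refine (Submodule.mem_bot ℂ).mp (lie_mem_of_forall_outer_mem (fun r => ?_) x)
  have := ((isCoordPolynomial_outer v).comp_add α).eq_zero h (toC r - α)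
  rw [Submodule.mem_bot]
  simpa using this

lemma OuterSqZero.not_isIrreducible [Nontrivial V] (h : OuterSqZero n V)
    (hnt : ∃ (x : sp n) (v : V), ⁅x, v⁆ ≠ 0) :
    ¬LieModule.IsIrreducible ℂ (H n) (F α β V) := by
  obtain ⟨x, v, hxv⟩ := hnt
  obtain ⟨s₁, hs₁⟩ : ∃ s : Lat n, ⁅outer (toC s + α), v⁆ ≠ 0 := by
    by_contra! hall
    exact hxv (lie_eq_zero_of_forall_shift α hall x)
  refine not_isIrreducible_of_family β
    (fun s => LinearMap.ker (LieModule.toEnd ℂ (sp n) V (outer (toC s + α))))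
    (fun r s w hw => ?_) (s₀ := 0) (s₁ := s₁) (fun hb => ?_) (fun ht => ?_)
  · rw [LinearMap.mem_ker, LieModule.toEnd_apply_apply] at hw ⊢
    rw [toC_add, add_assoc]
    exact h.lie_outer_add_eq_zero _ _ hw
  -- A square-zero operator on a nonzero space is not injective, so the kernel in degree 0 is
  -- nonzero.
  · obtain ⟨u, hu⟩ := exists_ne (0 : V)
    have hinj : ∀ w : V, ⁅outer (toC 0 + α), w⁆ = 0 → w = 0 := fun w hw =>
      (Submodule.mem_bot ℂ).mp (hb ▸ LinearMap.mem_ker.mpr hw)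
    exact hu (hinj _ (hinj _ (h _ u)))
  · exact hs₁ (LinearMap.mem_ker.mp (ht ▸ Submodule.mem_top :
      v ∈ LinearMap.ker (LieModule.toEnd ℂ (sp n) V (outer (toC s₁ + α)))))

end Irreducibility

/-! ### Modules with trivial action -/

section TrivialAction

variable {n : ℕ} {α β : Idx n → ℂ} {V : Type*} [AddCommGroup V] [Module ℂ V]
  [LieRingModule (sp n) V]

lemma submodule_eq_top_of_trivial (hV : LieModule.IsIrreducible ℂ (sp n) V)
    (ht : ∀ (x : sp n) (v : V), ⁅x, v⁆ = 0) {p : Submodule ℂ V} {v : V} (hv : v ∈ p)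
    (hv0 : v ≠ 0) : p = ⊤ := by
  let N : LieSubmodule ℂ (sp n) V :=
    { p with lie_mem := fun {x w} _ => by rw [ht]; exact p.zero_mem }
  have hN : N = ⊤ := (hV.eq_bot_or_eq_top N).resolve_left fun hb => by
    have hvN : v ∈ N := hv
    rw [hb, LieSubmodule.mem_bot] at hvN
    exact hv0 hvN
  exact congrArg LieSubmodule.toSubmodule hN

lemma nonempty_equiv_trivial_iff (hV : LieModule.IsIrreducible ℂ (sp n) V) :
    Nonempty (V ≃ₗ⁅ℂ, sp n⁆ TrivialLieModule ℂ (sp n) ℂ) ↔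
      ∀ (x : sp n) (v : V), ⁅x, v⁆ = 0 := by
  refine ⟨fun ⟨e⟩ x v => ?_, fun ht => ?_⟩
  · apply e.injective
    change e.toLieModuleHom ⁅x, v⁆ = e.toLieModuleHom 0
    rw [LieModuleHom.map_lie, trivial_lie_zero, map_zero]
  · have := LieModule.nontrivial_of_isIrreducible ℂ (sp n) V
    obtain ⟨v, hv⟩ := exists_ne (0 : V)
    have hbij : Function.Bijective (LinearMap.toSpanSingleton ℂ V v) := by
      refine ⟨smul_left_injective ℂ hv, LinearMap.range_eq_top.mp ?_⟩
      exact submodule_eq_top_of_trivial hV ht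
        (LinearMap.mem_range_self (LinearMap.toSpanSingleton ℂ V v) 1) (by simpa using hv)
    let e : V ≃ₗ[ℂ] TrivialLieModule ℂ (sp n) ℂ :=
      (LinearEquiv.ofBijective _ hbij).symm.trans (TrivialLieModule.equiv ℂ (sp n) ℂ).symm
    exact ⟨{ e with
      map_lie' := fun {x m} => by
        rw [ht, trivial_lie_zero]
        exact map_zero e }⟩

lemma exists_lat_dotProduct_ne_zero {a : Idx n → ℂ} (ha : a ≠ 0) :
    ∃ q : Lat n, bar (toC q) ⬝ᵥ a ≠ 0 := by
  obtain ⟨i, hi⟩ := Function.ne_iff.mp ha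
  rcases i with i | i
  · exact ⟨Pi.single (Sum.inr i) 1, by
      rw [toC_single, bar_unit_inr, unit_dotProduct]; exact hi⟩
  · exact ⟨Pi.single (Sum.inl i) 1, by
      rw [toC_single, bar_unit_inl, neg_dotProduct, unit_dotProduct]; exact neg_ne_zero.mpr hi⟩

/-- Two proper subgroups do not cover ℤ^N: with p good for a and q good for b, one of p, q, p + q is
good for both. -/
lemma exists_lat_dotProduct_ne_zero₂ {a b : Idx n → ℂ} (ha : a ≠ 0) (hb : b ≠ 0) :
    ∃ q : Lat n, bar (toC q) ⬝ᵥ a ≠ 0 ∧ bar (toC q) ⬝ᵥ b ≠ 0 := by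
  obtain ⟨p, hp⟩ := exists_lat_dotProduct_ne_zero ha
  obtain ⟨q, hq⟩ := exists_lat_dotProduct_ne_zero hb
  by_cases hpb : bar (toC p) ⬝ᵥ b = 0
  · by_cases hqa : bar (toC q) ⬝ᵥ a = 0
    · refine ⟨p + q, ?_, ?_⟩
      · rwa [toC_add, bar_add, add_dotProduct, hqa, add_zero]
      · rwa [toC_add, bar_add, add_dotProduct, hpb, zero_add]
    · exact ⟨q, hqa, hq⟩
  · exact ⟨p, hp, hpb⟩

variable [LieModule ℂ (sp n) V]

lemma isIrreducible_iff_of_trivial (hn : 0 < n) (hV : LieModule.IsIrreducible ℂ (sp n) V)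
    (ht : ∀ (x : sp n) (v : V), ⁅x, v⁆ = 0) :
    LieModule.IsIrreducible ℂ (H n) (F α β V) ↔ α ∉ Set.range (toC (n := n)) := by
  have := LieModule.nontrivial_of_isIrreducible ℂ (sp n) V
  constructor
  · rintro hirr ⟨s, rfl⟩
    classical
    -- If α = s is integral, all H_r kill V ⊗ t^{-s}, since the factor (r̄, -s + α) is zero; so this
    -- one component is a proper submodule.
    refine not_isIrreducible_of_family β
      (fun p => if toC p + toC s = 0 then (⊤ : Submodule ℂ V) else ⊥)
      (fun r p v hv => ?_) (s₀ := -s) (s₁ := -s + Pi.single (Sum.inl ⟨0, hn⟩) 1) ?_ ?_ hirr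
    · rw [ht, add_zero]
      by_cases hp : toC p + toC s = 0
      · rw [hp, dotProduct_zero, zero_smul]
        exact Submodule.zero_mem _
      · rw [if_neg hp, Submodule.mem_bot] at hv
        rw [hv, smul_zero]
        exact Submodule.zero_mem _
    · rw [← toC_add, neg_add_cancel, toC_zero, if_pos rfl]
      exact top_ne_bot
    · rw [← toC_add, neg_add_cancel_comm, toC_single, if_neg]
      · exact bot_ne_top
      · intro h
        have := congrFun h (Sum.inl ⟨0, hn⟩)
        simp [unit] at this
  · intro hα
    have := F.nontrivial (α := α) (β := β) (V := V)
    have hne : ∀ s : Lat n, toC s + α ≠ 0 := fun s hs => hα ⟨-s, by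
      ext i
      have := congrFun hs i
      simp only [Pi.add_apply, toC_apply, Pi.zero_apply] at this
      rw [toC_apply, Pi.neg_apply, Int.cast_neg]
      linear_combination -this⟩
    refine LieModule.IsIrreducible.mk fun M hM => ?_
    obtain ⟨s, v, hv, hv0⟩ := exists_fiber_ne_bot hM
    refine eq_top_of_fiber fun p w => ?_
    -- With m = p - s, the k² coefficient is -(q̄, p + α)(q̄, s + α) v, so q is chosen to make both
    -- factors nonzero.
    obtain ⟨q, hq, hq'⟩ := exists_lat_dotProduct_ne_zero₂ (hne s) (hne p)
    have h2 := doubleCoeff_mem_fiber hv (p - s) q (i := 2) (by norm_num)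
    rw [sub_add_cancel] at h2
    simp only [doubleCoeff, ht, smul_zero, zero_add, add_zero, sub_zero] at h2
    have e : bar (toC (p - s)) ⬝ᵥ toC q - bar (toC q) ⬝ᵥ (toC s + α) =
        -(bar (toC q) ⬝ᵥ (toC p + α)) := by
      rw [bar_dotProduct_comm, show toC p = toC (p - s) + toC s by
        rw [← toC_add, sub_add_cancel]]
      simp only [dotProduct_add]
      ring
    rw [e] at h2
    have htop := submodule_eq_top_of_trivial hV ht h2
      (smul_ne_zero (mul_ne_zero (neg_ne_zero.mpr hq') hq) hv0)
    rw [htop]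
    exact Submodule.mem_top

end TrivialAction

end Hamiltonian

end

theorem mainTheorem1 (n : ℕ) (hn : 0 < n) (α β : Hamiltonian.Idx n → ℂ)
    (V : Type*) [AddCommGroup V] [Module ℂ V]
    [LieRingModule (Hamiltonian.sp n) V] [LieModule ℂ (Hamiltonian.sp n) V]
    (hV : LieModule.IsIrreducible ℂ (Hamiltonian.sp n) V) :
    LieModule.IsIrreducible ℂ (Hamiltonian.H n) (Hamiltonian.F α β V) ↔
      (¬ FiniteDimensional ℂ V) ∨
      (FiniteDimensional ℂ V ∧ ∀ k : ℕ, k ≤ n → ¬ Hamiltonian.IsFundamental n V k) ∨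
      (Nonempty (V ≃ₗ⁅ℂ, Hamiltonian.sp n⁆ TrivialLieModule ℂ (Hamiltonian.sp n) ℂ) ∧
        α ∉ Set.range (Hamiltonian.toC (n := n))) := by
  have := LieModule.nontrivial_of_isIrreducible ℂ (Hamiltonian.sp n) V
  rw [Hamiltonian.nonempty_equiv_trivial_iff hV]
  by_cases hT : Hamiltonian.OuterSqZero n V
  · have hfd := hT.finiteDimensional hV
    obtain ⟨k, hk, hfund⟩ := hT.exists_isFundamental hV
    have h1 : ¬∀ k : ℕ, k ≤ n → ¬ Hamiltonian.IsFundamental n V k := fun h => h k hk hfund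
    simp only [hfd, not_true_eq_false, h1, and_false, false_or]
    by_cases ht : ∀ (x : Hamiltonian.sp n) (v : V), ⁅x, v⁆ = 0
    · rw [Hamiltonian.isIrreducible_iff_of_trivial hn hV ht]
      exact ⟨fun h => ⟨ht, h⟩, fun h => h.2⟩
    · refine iff_of_false (hT.not_isIrreducible ?_) fun h => ht h.1
      push Not at ht
      exact ht
  -- When the squares do not all vanish, a finite-dimensional V cannot be any V(δ_k), so one of the
  -- first two conditions holds.
  · refine iff_of_true (Hamiltonian.isIrreducible_of_not_outerSqZero hV hT) ?_
    by_cases hfd : FiniteDimensional ℂ V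
    · exact Or.inr (Or.inl ⟨hfd, fun k _ h => hT (h.outerSqZero hn)⟩)
    · exact Or.inl hfd
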